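/- Let $a<b$ be real. Let $f:[a,b]\to\mathbb{R}$ be decreasing and continuously differentiable with $0<\inf_{[a,b]}|f'|\le\sup_{[a,b]}|f'|<\infty$, and put $F(t)=\int_a^t f(x)\,dx$. Let $L:[a,b]\to\mathbb{R}$ be increasing and continuously differentiable with $0<\inf_{[a,b]}L'\le\sup_{[a,b]}L'<\infty$. For each $n$ let $F_n$ be a random cadlag step function on $[a,b]$, and let $B_n$, defined on the same probability space as $F_n$, be either a standard (if $L(a)<0$, two-sided) Brownian motion on $[L(a),L(b)]$ or, when $[L(a),L(b)]\subseteq[0,1]$, a standard Brownian bridge restricted to $[L(a),L(b)]$. Assume that $$\sup_{t\in[a,b]}\bigl|F_n(t)-F(t)-n^{-1/2}B_n(L(t))\bigr|=O_p(\gamma_n),\qquad \gamma_n=O\bigl((n^{-1}\log n)^{2/3}\bigr).$$ Let $\widehat F_n$ be the least concave majorant of $F_n$ on $[a,b]$. Let $K:\mathbb{R}\to[0,\infty)$ satisfy $\int K=1$, be supported on $[-1,1]$, and have integrable first and second derivatives, in the sense that $K$ is differentiable, $K'$ is locally absolutely continuous, and $K',K''\in L^1(\mathbb{R})$. Let $h_n>0$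 be (possibly random) bandwidths with $\mathbb{P}(2h_n\le b-a)\to1$. For $G\in\{F_n,\widehat F_n\}$ put $$f_{n,G}(t)=\frac1{h_n}\int_{\mathbb{R}}K\Bigl(\frac{t-x}{h_n}\Bigr)\,dG(x),\qquad t\in[a+h_n,b-h_n],$$ and extend linearly to the boundary intervals: $f_{n,G}(t)=f_{n,G}(a+h_n)+f_{n,G}'(a+h_n)(t-a-h_n)$ for $t\in[a,a+h_n]$ and $f_{n,G}(t)=f_{n,G}(b-h_n)+f_{n,G}'(b-h_n)(t-b+h_n)$ for $t\in[b-h_n,b]$. Let $\widetilde f_n=f_{n,F_n}$ (ordinary kernel estimator) and $\widehat f_{ns}=f_{n,\widehat F_n}$ (smoothed Grenander-type estimator). Whenever $2h_n\le b-a$, both estimators are differentiable on $[a,b]$, and for $l=0,1$ their $l$-th derivatives satisfy $$\sup_{t\in[a,b]}\bigl|\widehat f_{ns}^{(l)}(t)-\widetilde f_n^{(l)}(t)\bigr|=O_p\bigl(h_n^{-(1+l)}n^{-2/3}(\log n)^{2/3}\bigr).$$ Here $X_n=O_p(r_n)$ means that for every $\varepsilon>0$ there is $M$ with $\mathbb{P}(|X_n|>M|r_n|)\le\varepsilon$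 for all large $n$. -/

import Mathlib

open Set Filter Topology MeasureTheory ProbabilityTheory
open scoped ENNReal

noncomputable section

/-! ### Stochastic order and supremum norms -/

/-- `X_n = O_p(r_n)` for `[0, ∞]`-valued `X_n` and real, possibly random, rates `r_n`:
for every `ε > 0` there is an `M` with `P (X_n > M |r_n|) ≤ ε` for all large `n`.
The `n`-th variable may live on its own probability space. -/
def IsBigOInProb {Ω : ℕ → Type*} [∀ n, MeasurableSpace (Ω n)] (P : ∀ n, Measure (Ω n))
    (X : ∀ n, Ω n → ℝ≥0∞) (r : ∀ n, Ω n → ℝ) : Prop :=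
  ∀ ε : ℝ, 0 < ε → ∃ M : ℝ, 0 < M ∧ ∀ᶠ n in atTop,
    P n {ω | ENNReal.ofReal (M * |r n ω|) < X n ω} ≤ ENNReal.ofReal ε

/-- `sup_{t ∈ [a,b]} |g t|`, as an element of `[0, ∞]`. -/
def supAbs (a b : ℝ) (g : ℝ → ℝ) : ℝ≥0∞ := ⨆ t ∈ Icc a b, ‖g t‖ₑ

/-! ### The setting -/

/-- `f` is decreasing and continuously differentiable on `[a,b]`,
with `0 < inf |f'| ≤ sup |f'| < ∞`. -/
structure IsSmoothDecreasing (a b : ℝ) (f : ℝ → ℝ) : Prop where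
  antitoneOn : AntitoneOn f (Icc a b)
  contDiffOn : ContDiffOn ℝ 1 f (Icc a b)
  abs_deriv_bounds : ∃ c C : ℝ, 0 < c ∧
    ∀ t ∈ Icc a b, c ≤ |derivWithin f (Icc a b) t| ∧ |derivWithin f (Icc a b) t| ≤ C

/-- `L` is increasing and continuously differentiable on `[a,b]`,
with `0 < inf L' ≤ sup L' < ∞`. -/
structure IsSmoothIncreasing (a b : ℝ) (L : ℝ → ℝ) : Prop where
  monotoneOn : MonotoneOn L (Icc a b)
  contDiffOn : ContDiffOn ℝ 1 L (Icc a b)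
  deriv_bounds : ∃ c C : ℝ, 0 < c ∧
    ∀ t ∈ Icc a b, c ≤ derivWithin L (Icc a b) t ∧ derivWithin L (Icc a b) t ≤ C

/-- `G` is a cadlag step function on `[a,b]`: there are finitely many points such that `G` takes
the same value at any two points of `[a,b]` that are not separated by one of them, a point `τ`
separating `{x < τ}` from `{x ≥ τ}`. -/
def IsCadlagStepOn (a b : ℝ) (G : ℝ → ℝ) : Prop :=
  ∃ s : Finset ℝ, ∀ x ∈ Icc a b, ∀ y ∈ Icc a b, (∀ τ ∈ s, τ ≤ x ↔ τ ≤ y) → G x = G y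

/-- The restriction of `B` to the index set `I ⊆ ℝ` is a standard Brownian motion
(two-sided if `I` meets both half-lines): a centred Gaussian process with almost surely continuous
paths and covariance `(|s| + |t| - |s - t|) / 2`, which is `min s t` when `s, t ≥ 0`. -/
structure IsBrownianMotionOn {Ω : Type*} [MeasurableSpace Ω] (I : Set ℝ) (B : ℝ → Ω → ℝ)
    (P : Measure Ω) : Prop where
  isGaussianProcess : IsGaussianProcess (fun t : I ↦ B t) P
  integral_eq_zero : ∀ t ∈ I, ∫ ω, B t ω ∂P = 0
  covariance_eq : ∀ s ∈ I, ∀ t ∈ I, cov[B s, B t; P] = (|s| + |t| - |s - t|) / 2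
  continuousOn : ∀ᵐ ω ∂P, ContinuousOn (fun t ↦ B t ω) I

/-- The restriction of `B` to the index set `I ⊆ [0,1]` is a standard Brownian bridge:
a centred Gaussian process with almost surely continuous paths and covariance `min s t - s t`. -/
structure IsBrownianBridgeOn {Ω : Type*} [MeasurableSpace Ω] (I : Set ℝ) (B : ℝ → Ω → ℝ)
    (P : Measure Ω) : Prop where
  subset : I ⊆ Icc 0 1
  isGaussianProcess : IsGaussianProcess (fun t : I ↦ B t) P
  integral_eq_zero : ∀ t ∈ I, ∫ ω, B t ω ∂P = 0
  covariance_eq : ∀ s ∈ I, ∀ t ∈ I, cov[B s, B t; P] = min s t - s * t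
  continuousOn : ∀ᵐ ω ∂P, ContinuousOn (fun t ↦ B t ω) I

/-! ### The estimators -/

/-- The least concave majorant of `G` on `[a,b]`: the pointwise infimum of all the functions
that are concave on `[a,b]` and lie above `G` there. -/
def leastConcaveMajorant (a b : ℝ) (G : ℝ → ℝ) (x : ℝ) : ℝ :=
  sInf {y | ∃ g : ℝ → ℝ, ConcaveOn ℝ (Icc a b) g ∧ (∀ t ∈ Icc a b, G t ≤ g t) ∧ g x = y}

/-- The extension of `G` from `[a,b]` to `ℝ` that is constant on `(-∞,a]` and on `[b,∞)`. -/
def extendConst (a b : ℝ) (G : ℝ → ℝ) (x : ℝ) : ℝ := G (max a (min b x))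

open Classical in
/-- The Lebesgue-Stieltjes integral `∫ g dG` of `g` against a right-continuous function `G` of
bounded variation on `[a,b]` (extended to `ℝ` by constants); `0` if `G` is not of bounded
variation on `[a,b]`. -/
def stieltjesIntegral (a b : ℝ) (g G : ℝ → ℝ) : ℝ :=
  if hG : BoundedVariationOn (extendConst a b G) univ then ∫ᵛ x, g x ∂•hG.vectorMeasure else 0

/-- A kernel: a probability density on `ℝ` which is supported on `[-1,1]`. -/
structure IsKernel (K : ℝ → ℝ) : Prop where
  nonneg : ∀ u, 0 ≤ K u
  integral_eq_one : ∫ u, K u = 1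
  support_subset : Function.support K ⊆ Icc (-1) 1

/-- `K` has integrable first and second derivatives: `K` is differentiable, `K'` is locally
absolutely continuous (so that it is a primitive of `K''`, which exists almost everywhere), and
`K'` and `K''` are integrable. This covers every `K` which is twice differentiable everywhere with
`K'` and `K''` integrable, and also kernels such as `(15/16) (1 - u²)²` on `[-1,1]`. -/
structure HasIntegrableDerivatives (K : ℝ → ℝ) : Prop where
  differentiable : Differentiable ℝ K
  absolutelyContinuous : ∀ x y, AbsolutelyContinuousOnInterval (deriv K) x y
  integrable_deriv : Integrable (deriv K)
  integrable_deriv_deriv : Integrable (deriv (deriv K))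

/-- `h⁻¹ ∫ K ((t - x) / h) dG(x)`. -/
def kernelSmooth (a b : ℝ) (K : ℝ → ℝ) (h : ℝ) (G : ℝ → ℝ) (t : ℝ) : ℝ :=
  h⁻¹ * stieltjesIntegral a b (fun x ↦ K ((t - x) / h)) G

/-- The kernel estimator with bandwidth `h` built from `G`, on `[a,b]`: the kernel smooth of `G` on
`[a + h, b - h]`, continued on the two boundary intervals by its tangent lines at `a + h` and
`b - h`. -/
def kernelEstimator (a b : ℝ) (K : ℝ → ℝ) (h : ℝ) (G : ℝ → ℝ) (t : ℝ) : ℝ :=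
  if t < a + h then
    kernelSmooth a b K h G (a + h) + deriv (kernelSmooth a b K h G) (a + h) * (t - a - h)
  else if t ≤ b - h then
    kernelSmooth a b K h G t
  else
    kernelSmooth a b K h G (b - h) + deriv (kernelSmooth a b K h G) (b - h) * (t - b + h)

/-- The smoothed Grenander-type estimator: the kernel estimator built from the least concave
majorant of `G`. -/
def smoothedGrenander (a b : ℝ) (K : ℝ → ℝ) (h : ℝ) (G : ℝ → ℝ) : ℝ → ℝ :=
  kernelEstimator a b K h (leastConcaveMajorant a b G)

end

/-! Both estimators are the same linear functional of their integrator, so their difference is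
controlled by `D = sup |F̂_n - F_n|`, where `F̂_n` is the least concave majorant of `F_n`.
Integration by parts moves the derivative onto the kernel: `h⁻¹ ∫ K((t-x)/h) dG(x) = h⁻² ∫
K'((t-x)/h) G(x) dx`. The smooths therefore differ by at most `h⁻¹ ‖K'‖₁ D`, and their derivatives
by at most `h⁻² ‖K''‖₁ D`. On a boundary strip the tangent extension adds a derivative difference
times a length at most `h`, which has the order of the first bound. These estimates hold path by
path (`abs_iteratedDerivWithin_kernelEstimator_sub_le`), so random bandwidths do no harm.

It remains to show `D = O_p(δ²)` with `δ = (log n / n)^(1/3)`, which is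
`isBigOInProb_supAbs_leastConcaveMajorant_sub`. Since `f' ≤ -c`, `F(x) ≤ F(t) + f(t)(x-t) -
(c/2)(x-t)²`. Suppose the noise `w = n^(-1/2) B_n ∘ L` satisfies `|w(x) - w(t)| ≤ A δ² + A' δ |x-t|`
for all `x`, `t`. The curvature absorbs the linear term, so the line through `(t, F_n(t))` of slope
`f(t)`, raised by a multiple of `δ²` plus twice the approximation error, lies above `F_n`. It then
lies above the majorant, and evaluation at `t` gives the bound.

The noise bound comes from chaining over dyadic refinements of a grid with about `1/δ` cells.
Brownian increments over a cell are of order `√δ`, at most of order `√(δ log n)` uniformly over the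
cells, and `n^(-1/2) √(δ log n) = δ²` because `δ³ = log n / n`. Only Gaussian tails with increment
variance at most `|s-t|` enter, so motion and bridge are treated alike. -/

/-! ### Bounded variation of step functions and of concave functions -/

/-- A cadlag step function factors through a bounded monotone counting function. -/
lemma IsCadlagStepOn.exists_eq_comp_count {a b : ℝ} {G : ℝ → ℝ} (hG : IsCadlagStepOn a b G) :
    ∃ (N : ℕ) (c : ℝ → ℕ) (φ : ℕ → ℝ), Monotone c ∧ (∀ x, c x ≤ N) ∧
      ∀ x ∈ Icc a b, G x = φ (c x) := by
  classical
  obtain ⟨s, hs⟩ := hG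
  set c : ℝ → ℕ := fun x ↦ (s.filter (· ≤ x)).card with hc
  have hsub : ∀ x y, x ≤ y → s.filter (· ≤ x) ⊆ s.filter (· ≤ y) := by
    intro x y hxy τ hτ
    simp only [Finset.mem_filter] at hτ ⊢
    exact ⟨hτ.1, hτ.2.trans hxy⟩
  have hkey : ∀ x ∈ Icc a b, ∀ y ∈ Icc a b, c x = c y → G x = G y := by
    intro x hx y hy hxy
    apply hs x hx y hy
    -- The two filters are nested, so equal cardinality forces equality.
    have : s.filter (· ≤ x) = s.filter (· ≤ y) := by
      rcases le_total x y with h | h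
      · exact Finset.eq_of_subset_of_card_le (hsub x y h) hxy.ge
      · exact (Finset.eq_of_subset_of_card_le (hsub y x h) hxy.le).symm
    intro τ hτ
    have := Finset.ext_iff.1 this τ
    simpa [hτ] using this
  refine ⟨s.card, c, fun k ↦ if h : ∃ x ∈ Icc a b, c x = k then G h.choose else 0,
    fun x y hxy ↦ Finset.card_le_card (hsub x y hxy),
    fun x ↦ Finset.card_le_card (Finset.filter_subset _ _), fun x hx ↦ ?_⟩
  have h : ∃ y ∈ Icc a b, c y = c x := ⟨x, hx, rfl⟩
  simp only [h, dif_pos]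
  exact hkey x hx _ h.choose_spec.1 h.choose_spec.2.symm

lemma IsCadlagStepOn.exists_abs_le {a b : ℝ} {G : ℝ → ℝ} (hG : IsCadlagStepOn a b G) :
    ∃ M, ∀ x ∈ Icc a b, |G x| ≤ M := by
  obtain ⟨N, c, φ, -, hcN, hφ⟩ := hG.exists_eq_comp_count
  refine ⟨∑ k ∈ Finset.range (N + 1), |φ k|, fun x hx ↦ ?_⟩
  rw [hφ x hx]
  exact Finset.single_le_sum (f := fun k ↦ |φ k|) (fun _ _ ↦ abs_nonneg _)
    (Finset.mem_range.2 (Nat.lt_succ_of_le (hcN x)))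

lemma IsCadlagStepOn.boundedVariationOn {a b : ℝ} {G : ℝ → ℝ} (hG : IsCadlagStepOn a b G) :
    BoundedVariationOn G (Icc a b) := by
  obtain ⟨N, c, φ, hc, hcN, hφ⟩ := hG.exists_eq_comp_count
  have h1 : eVariationOn G (Icc a b) = eVariationOn (φ ∘ c) (Icc a b) :=
    eVariationOn.congr fun x hx ↦ hφ x hx
  have h2 : eVariationOn (φ ∘ c) (Icc a b) ≤ eVariationOn φ (Iic N) :=
    eVariationOn.comp_le_of_monotoneOn φ c (hc.monotoneOn _) fun x _ ↦ hcN x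
  have h3 : BoundedVariationOn φ (Iic N) := BoundedVariationOn.of_finite φ (Iic N)
  rw [BoundedVariationOn, h1]
  exact (h2.trans_lt h3.lt_top).ne

lemma BoundedVariationOn.fun_add {f g : ℝ → ℝ} {s : Set ℝ} (hf : BoundedVariationOn f s)
    (hg : BoundedVariationOn g s) : BoundedVariationOn (fun x ↦ f x + g x) s := by
  refine ne_of_lt (lt_of_le_of_lt (b := eVariationOn f s + eVariationOn g s) ?_
    (ENNReal.add_lt_top.2 ⟨hf.lt_top, hg.lt_top⟩))
  refine iSup_le ?_
  rintro ⟨n, u, hu, hus⟩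
  calc ∑ i ∈ Finset.range n, edist (f (u (i + 1)) + g (u (i + 1))) (f (u i) + g (u i))
      ≤ ∑ i ∈ Finset.range n, (edist (f (u (i + 1))) (f (u i)) +
          edist (g (u (i + 1))) (g (u i))) := by
        gcongr with i _
        exact edist_add_add_le _ _ _ _
    _ ≤ _ := by
        rw [Finset.sum_add_distrib]
        exact add_le_add (eVariationOn.sum_le hu hus) (eVariationOn.sum_le hu hus)

lemma MonotoneOn.boundedVariationOn_Icc {g : ℝ → ℝ} {a b : ℝ} (hab : a ≤ b)
    (hg : MonotoneOn g (Icc a b)) : BoundedVariationOn g (Icc a b) := by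
  refine hg.boundedVariationOn (C := max |g a| |g b|) fun x hx ↦ ?_
  exact abs_le_max_abs_abs (hg (left_mem_Icc.2 hab) hx hx.1) (hg hx (right_mem_Icc.2 hab) hx.2)

lemma MonotoneOn.boundedVariationOn_of_sub_linear {g : ℝ → ℝ} {a b m : ℝ} (hab : a ≤ b)
    (hg : MonotoneOn (fun x ↦ g x - m * x) (Icc a b)) : BoundedVariationOn g (Icc a b) := by
  have h1 := hg.boundedVariationOn_Icc hab
  have h2 : BoundedVariationOn (fun x : ℝ ↦ m * x) (Icc a b) := by
    have := (BoundedVariationOn.id_Icc a b)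
    exact (LipschitzWith.of_dist_le_mul (K := ‖m‖₊) (f := fun x : ℝ ↦ m * x) fun x y ↦ by
      simp [Real.dist_eq, ← mul_sub, abs_mul]).comp_boundedVariationOn this
  have := h1.fun_add h2
  simpa using this

/-- Slopes may be unbounded at both ends, but only upwards at `a` and downwards at `b`. On the left
half they are at least the slope over the right half, so subtracting a linear function leaves a
monotone one; the right half is the mirror image. -/
lemma ConcaveOn.boundedVariationOn {g : ℝ → ℝ} {a b : ℝ} (hab : a < b)
    (hg : ConcaveOn ℝ (Icc a b) g) : BoundedVariationOn g (Icc a b) := by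
  set c := (a + b) / 2 with hc
  have hac : a < c := by simp only [hc]; linarith
  have hcb : c < b := by simp only [hc]; linarith
  have h1 : BoundedVariationOn g (Icc a c) := by
    refine MonotoneOn.boundedVariationOn_of_sub_linear (m := (g b - g c) / (b - c)) hac.le ?_
    intro x hx y hy hxy
    rcases hxy.eq_or_lt with rfl | hxy
    · exact le_rfl
    have h1 : (g b - g c) / (b - c) ≤ (g y - g x) / (y - x) := by
      rcases hy.2.eq_or_lt with rfl | hyc
      · exact hg.slope_anti_adjacent ⟨hx.1, by linarith⟩ (right_mem_Icc.2 hab.le) hxy hcb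
      · exact (hg.slope_anti_adjacent ⟨hy.1, by linarith⟩ (right_mem_Icc.2 hab.le) hyc hcb).trans
          (hg.slope_anti_adjacent ⟨hx.1, by linarith⟩ ⟨hac.le, hcb.le⟩ hxy hyc)
    rw [le_div_iff₀ (by linarith)] at h1
    simp only
    linarith
  have h2 : BoundedVariationOn g (Icc c b) := by
    have : BoundedVariationOn (fun x ↦ - g x) (Icc c b) := by
      refine MonotoneOn.boundedVariationOn_of_sub_linear (m := -((g c - g a) / (c - a))) hcb.le ?_
      intro x hx y hy hxy
      rcases hxy.eq_or_lt with rfl | hxy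
      · exact le_rfl
      have h1 : (g y - g x) / (y - x) ≤ (g c - g a) / (c - a) := by
        rcases hx.1.eq_or_lt with rfl | hcx
        · exact hg.slope_anti_adjacent (left_mem_Icc.2 hab.le) ⟨by linarith, hy.2⟩ hac hxy
        · exact (hg.slope_anti_adjacent ⟨hac.le, hcb.le⟩ ⟨by linarith, hy.2⟩ hcx hxy).trans
            (hg.slope_anti_adjacent (left_mem_Icc.2 hab.le) ⟨by linarith, hx.2⟩ hac hcx)
      rw [div_le_iff₀ (by linarith)] at h1
      simp only
      linarith
    have h3 := (LipschitzWith.id.neg (α := ℝ)).comp_boundedVariationOn this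
    simpa [Function.comp_def] using h3
  have := eVariationOn.Icc_add_Icc g hac.le hcb.le (mem_univ c)
  simp only [univ_inter] at this
  rw [BoundedVariationOn, ← this]
  exact ENNReal.add_ne_top.2 ⟨h1, h2⟩

lemma BoundedVariationOn.extendConst {a b : ℝ} (hab : a ≤ b) {G : ℝ → ℝ}
    (hG : BoundedVariationOn G (Icc a b)) : BoundedVariationOn (extendConst a b G) univ := by
  refine ne_of_lt (lt_of_le_of_lt ?_ hG.lt_top)
  refine eVariationOn.comp_le_of_monotoneOn G (fun x ↦ max a (min b x)) ?_ ?_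
  · intro x _ y _ hxy
    exact max_le_max le_rfl (min_le_min le_rfl hxy)
  · intro x _
    exact ⟨le_max_left _ _, max_le hab (min_le_left _ _)⟩

/-! ### The least concave majorant -/

/-- The bound on `G` provides a constant majorant; without any majorant the infimum would be over
the empty set and take its default value `0`. -/
lemma le_leastConcaveMajorant {a b M : ℝ} {G : ℝ → ℝ} (hM : ∀ x ∈ Icc a b, G x ≤ M)
    {x : ℝ} (hx : x ∈ Icc a b) : G x ≤ leastConcaveMajorant a b G x := by
  refine le_csInf ⟨M, fun _ ↦ M, concaveOn_const M (convex_Icc a b), hM, rfl⟩ ?_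
  rintro y ⟨g, -, hgG, rfl⟩
  exact hgG x hx

lemma leastConcaveMajorant_le {a b : ℝ} {G g : ℝ → ℝ} (hg : ConcaveOn ℝ (Icc a b) g)
    (hgG : ∀ t ∈ Icc a b, G t ≤ g t) {x : ℝ} (hx : x ∈ Icc a b) :
    leastConcaveMajorant a b G x ≤ g x := by
  refine csInf_le ⟨G x, ?_⟩ ⟨g, hg, hgG, rfl⟩
  rintro y ⟨g', -, hg', rfl⟩
  exact hg' x hx

lemma concaveOn_leastConcaveMajorant {a b M : ℝ} {G : ℝ → ℝ} (hM : ∀ x ∈ Icc a b, G x ≤ M) :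
    ConcaveOn ℝ (Icc a b) (leastConcaveMajorant a b G) := by
  refine ⟨convex_Icc a b, fun x hx y hy p q hp hq hpq ↦ ?_⟩
  refine le_csInf ⟨M, fun _ ↦ M, concaveOn_const M (convex_Icc a b), hM, rfl⟩ ?_
  rintro z ⟨g, hg, hgG, rfl⟩
  refine le_trans ?_ (hg.2 hx hy hp hq hpq)
  have h1 := leastConcaveMajorant_le hg hgG hx
  have h2 := leastConcaveMajorant_le hg hgG hy
  simp only [smul_eq_mul]
  gcongr

lemma IsCadlagStepOn.boundedVariationOn_leastConcaveMajorant {a b : ℝ} (hab : a < b) {G : ℝ → ℝ}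
    (hG : IsCadlagStepOn a b G) : BoundedVariationOn (leastConcaveMajorant a b G) (Icc a b) := by
  obtain ⟨M, hM⟩ := hG.exists_abs_le
  exact (concaveOn_leastConcaveMajorant fun x hx ↦
    (le_abs_self _).trans (hM x hx)).boundedVariationOn hab

/-- If at each point `G` has an affine majorant exceeding it by at most `D` there, then `G` is
within `D` of its least concave majorant. -/
lemma abs_leastConcaveMajorant_sub_le {a b D M : ℝ} {G p : ℝ → ℝ} (hM : ∀ x ∈ Icc a b, G x ≤ M)
    (h : ∀ t ∈ Icc a b, ∀ x ∈ Icc a b, G x ≤ G t + p t * (x - t) + D) {t : ℝ}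
    (ht : t ∈ Icc a b) : |leastConcaveMajorant a b G t - G t| ≤ D := by
  have h1 := le_leastConcaveMajorant hM ht
  have h2 : leastConcaveMajorant a b G t ≤ G t + p t * (t - t) + D := by
    refine leastConcaveMajorant_le (g := fun x ↦ G t + p t * (x - t) + D) ?_ (h t ht) ht
    refine ⟨convex_Icc a b, fun x _ y _ u v _ _ huv ↦ le_of_eq ?_⟩
    simp only [smul_eq_mul]
    linear_combination (G t - p t * t + D) * huv
  rw [abs_of_nonneg (by linarith)]
  simp only [sub_self, mul_zero, add_zero] at h2
  linarith

/-! ### Integration by parts for Lebesgue-Stieltjes integrals -/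

lemma BoundedVariationOn.countable_not_continuousAt {G : ℝ → ℝ} (hG : BoundedVariationOn G univ) :
    {x | ¬ContinuousAt G x}.Countable := by
  obtain ⟨p, q, hp, hq, rfl⟩ := hG.locallyBoundedVariationOn.exists_monotoneOn_sub_monotoneOn
  rw [monotoneOn_univ] at hp hq
  refine (hp.countable_not_continuousAt.union hq.countable_not_continuousAt).mono fun x hx ↦ ?_
  by_contra h
  simp only [mem_union, mem_ofPred_eq, not_or, not_not] at h
  exact hx (h.1.sub h.2)

lemma BoundedVariationOn.exists_abs_le {G : ℝ → ℝ} (hG : BoundedVariationOn G univ) :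
    ∃ C, ∀ x, |G x| ≤ C := by
  refine ⟨(eVariationOn G univ).toReal + |G 0|, fun x ↦ ?_⟩
  have h1 := hG.dist_le (mem_univ x) (mem_univ 0)
  rw [Real.dist_eq] at h1
  have h2 := abs_add_le (G x - G 0) (G 0)
  simp only [sub_add_cancel] at h2
  linarith

lemma BoundedVariationOn.ae_continuousAt {G : ℝ → ℝ} (hG : BoundedVariationOn G univ) :
    ∀ᵐ x, ContinuousAt G x := by
  have := hG.countable_not_continuousAt.ae_notMem volume
  filter_upwards [this] with x hx
  simpa using hx

/-- Passing to the Jordan parts makes Fubini for positive measures available. -/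
lemma integral_signedMeasure_eq_sub (μ : SignedMeasure ℝ) {f : ℝ → ℝ} {C : ℝ}
    (hf : Measurable f) (hC : ∀ x, |f x| ≤ C) :
    ∫ᵛ x, f x ∂•μ = ∫ x, f x ∂μ.toJordanDecomposition.posPart -
      ∫ x, f x ∂μ.toJordanDecomposition.negPart := by
  have hflip : (ContinuousLinearMap.lsmul ℝ ℝ : ℝ →L[ℝ] ℝ →L[ℝ] ℝ) =
      (ContinuousLinearMap.lsmul ℝ ℝ : ℝ →L[ℝ] ℝ →L[ℝ] ℝ).flip := by
    ext; simp
  have hint : ∀ ν : Measure ℝ, IsFiniteMeasure ν → Integrable f ν := fun ν _ ↦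
    Integrable.of_bound hf.aestronglyMeasurable C (Eventually.of_forall hC)
  conv_lhs => rw [← μ.toSignedMeasure_toJordanDecomposition, hflip]
  rw [JordanDecomposition.toSignedMeasure, VectorMeasure.integral_sub_vectorMeasure,
    VectorMeasure.integral_toSignedMeasure, VectorMeasure.integral_toSignedMeasure]
  · rw [VectorMeasure.Integrable, Measure.variation_toSignedMeasure]
    exact hint _ inferInstance
  · rw [VectorMeasure.Integrable, Measure.variation_toSignedMeasure]
    exact hint _ inferInstance

/-- Integration by parts against a finite measure, for a function vanishing at `+∞`. -/
lemma integral_eq_neg_integral_deriv_mul_measure_Iio (ν : Measure ℝ) [IsFiniteMeasure ν]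
    {φ φ' : ℝ → ℝ} (hφ : ∀ x, HasDerivAt φ (φ' x) x) (hφ' : Integrable φ')
    (hlim : Tendsto φ atTop (𝓝 0)) :
    ∫ x, φ x ∂ν = - ∫ s, φ' s * ν.real (Iio s) := by
  have h1 : ∀ x, φ x = - ∫ s, (Ioi x).indicator φ' s := by
    intro x
    rw [integral_indicator measurableSet_Ioi,
      integral_Ioi_of_hasDerivAt_of_tendsto' (fun y _ ↦ hφ y) hφ'.integrableOn hlim]
    ring
  have hint : Integrable (fun z : ℝ × ℝ ↦ (Ioi z.1).indicator φ' z.2) (ν.prod volume) := by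
    have h : Integrable (fun z : ℝ × ℝ ↦ φ' z.2) (ν.prod volume) := hφ'.comp_snd ν
    have hs : MeasurableSet {z : ℝ × ℝ | z.1 < z.2} :=
      measurableSet_lt measurable_fst measurable_snd
    refine (h.indicator hs).congr (Eventually.of_forall fun z ↦ ?_)
    simp [indicator]
  calc ∫ x, φ x ∂ν = - ∫ x, (∫ s, (Ioi x).indicator φ' s) ∂ν := by
        rw [← integral_neg]; exact integral_congr_ae (Eventually.of_forall h1)
    _ = - ∫ s, (∫ x, (Ioi x).indicator φ' s ∂ν) := by rw [integral_integral_swap hint]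
    _ = - ∫ s, φ' s * ν.real (Iio s) := by
        congr 2 with s
        have : (fun x ↦ (Ioi x).indicator φ' s) = (Iio s).indicator fun _ ↦ φ' s := by
          ext x; simp [indicator]
        rw [this, integral_indicator measurableSet_Iio, setIntegral_const, smul_eq_mul, mul_comm]

/-- Integration by parts for the Lebesgue-Stieltjes integral of a `C¹` function with compact
support against a function of bounded variation. -/
lemma BoundedVariationOn.integral_vectorMeasure_eq {G : ℝ → ℝ} (hG : BoundedVariationOn G univ)
    {φ : ℝ → ℝ} (hφ : Differentiable ℝ φ) (hφ' : Integrable (deriv φ))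
    (hsupp : HasCompactSupport φ) :
    ∫ᵛ x, φ x ∂•hG.vectorMeasure = - ∫ s, deriv φ s * G s := by
  obtain ⟨C, hC⟩ := hφ.continuous.bounded_above_of_compact_support hsupp
  have htop : Tendsto φ atTop (𝓝 0) :=
    hsupp.is_zero_at_infty.mono_left atTop_le_cocompact
  have hbot : Tendsto φ atBot (𝓝 0) :=
    hsupp.is_zero_at_infty.mono_left atBot_le_cocompact
  have hzero : ∫ s, deriv φ s = 0 := by
    rw [integral_of_hasDerivAt_of_tendsto (fun x ↦ (hφ x).hasDerivAt) hφ' hbot htop, sub_zero]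
  obtain ⟨M, hM⟩ := hG.exists_abs_le
  have hGm : Measurable G := measurable_of_countable_not_continuousAt hG.countable_not_continuousAt
  rw [integral_signedMeasure_eq_sub _ hφ.continuous.measurable hC,
    integral_eq_neg_integral_deriv_mul_measure_Iio _ (fun x ↦ (hφ x).hasDerivAt) hφ' htop,
    integral_eq_neg_integral_deriv_mul_measure_Iio _ (fun x ↦ (hφ x).hasDerivAt) hφ' htop]
  have hint : ∀ ν : Measure ℝ, IsFiniteMeasure ν →
      Integrable fun s ↦ deriv φ s * ν.real (Iio s) := by
    intro ν _
    refine hφ'.mul_bdd (c := ν.real univ) ?_ (Eventually.of_forall fun s ↦ ?_)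
    · have hmono : Monotone fun s ↦ ν.real (Iio s) := fun s t hst ↦
        measureReal_mono (Iio_subset_Iio hst)
      exact hmono.measurable.aestronglyMeasurable
    · rw [Real.norm_of_nonneg measureReal_nonneg]
      exact measureReal_mono (subset_univ _)
  have hintG : Integrable fun s ↦ deriv φ s * G s :=
    hφ'.mul_bdd (c := M) hGm.aestronglyMeasurable (Eventually.of_forall hM)
  set μ : SignedMeasure ℝ := hG.vectorMeasure with hμ
  -- The mass of `Iio s` is the left limit of `G` at `s` minus the limit at `-∞`. The left limit
  -- equals `G s` off a countable set, and the constant disappears because `∫ φ' = 0`.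
  have key : ∫ s, (deriv φ s * μ.toJordanDecomposition.posPart.real (Iio s) -
      deriv φ s * μ.toJordanDecomposition.negPart.real (Iio s)) =
      ∫ s, (deriv φ s * G s - deriv φ s * limUnder atBot G) := by
    refine integral_congr_ae ?_
    filter_upwards [hG.ae_continuousAt] with s hs
    rw [← mul_sub, ← SignedMeasure.apply_eq_posPart_real_sub_negPart_real _ measurableSet_Iio,
      hμ, hG.vectorMeasure_Iio, hs.continuousWithinAt.leftLim_eq, mul_sub]
  rw [integral_sub (hint _ inferInstance) (hint _ inferInstance),
    integral_sub hintG (hφ'.mul_const _), integral_mul_const, hzero] at key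
  linarith

/-! ### Differentiating a convolution of an absolutely continuous function -/

/-- The convolution of an integrable function and a bounded, almost everywhere continuous function
is continuous. -/
lemma continuous_integral_comp_sub_mul {k G : ℝ → ℝ} {M : ℝ} (hk : Integrable k)
    (hGm : Measurable G) (hM : ∀ x, |G x| ≤ M) (hG : {x | ¬ContinuousAt G x}.Countable) :
    Continuous fun t ↦ ∫ x, k (t - x) * G x := by
  -- The factor `k` is merely integrable, so the variable `t` is moved to `G`, where dominated
  -- convergence applies.
  have h1 : (fun t ↦ ∫ x, k (t - x) * G x) = fun t ↦ ∫ u, k u * G (t - u) := by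
    ext t
    rw [← integral_sub_left_eq_self (fun x ↦ k (t - x) * G x) volume t]
    simp
  rw [h1, continuous_iff_continuousAt]
  intro t
  refine continuousAt_of_dominated (bound := fun u ↦ |k u| * M) ?_ ?_ ?_ ?_
  · refine Eventually.of_forall fun s ↦ hk.aestronglyMeasurable.mul ?_
    exact (hGm.comp (measurable_const.sub measurable_id)).aestronglyMeasurable
  · refine Eventually.of_forall fun s ↦ Eventually.of_forall fun u ↦ ?_
    rw [norm_mul]
    exact mul_le_mul_of_nonneg_left (hM _) (abs_nonneg _)
  · exact hk.abs.mul_const M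
  · have hcount : {u : ℝ | ¬ContinuousAt G (t - u)}.Countable :=
      hG.preimage_of_injOn (f := fun u : ℝ ↦ t - u) (fun x _ y _ h ↦ by simpa using h)
    filter_upwards [hcount.ae_notMem volume] with u hu
    have hu' : ContinuousAt G (t - u) := by simpa using hu
    exact continuousAt_const.mul
      (hu'.comp (f := fun s : ℝ ↦ s - u) (continuousAt_id.sub continuousAt_const))

/-- With `k'` only integrable, there need be no dominating function for differentiation under the
integral. Instead, Fubini exhibits the convolution with `k` as a primitive of the convolution with
`k'`, which is continuous, and the fundamental theorem of calculus concludes. -/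
lemma hasDerivAt_integral_comp_sub_mul {k k' G : ℝ → ℝ} {M : ℝ}
    (hkk' : ∀ x y, ∫ s in x..y, k' s = k y - k x) (hki : Integrable k)
    (hk : Integrable k') (hk'm : Measurable k')
    (hGm : Measurable G) (hM : ∀ x, |G x| ≤ M) (hG : {x | ¬ContinuousAt G x}.Countable) (t : ℝ) :
    HasDerivAt (fun t ↦ ∫ x, k (t - x) * G x) (∫ x, k' (t - x) * G x) t := by
  have hcont := continuous_integral_comp_sub_mul hk hGm hM hG
  have hint1 : ∀ t, Integrable fun x ↦ k (t - x) * G x := fun t ↦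
    (hki.comp_sub_left t).mul_bdd hGm.aestronglyMeasurable (Eventually.of_forall hM)
  have hint2 : ∀ t, Integrable fun x ↦ k' (t - x) * G x := fun t ↦
    (hk.comp_sub_left t).mul_bdd hGm.aestronglyMeasurable (Eventually.of_forall hM)
  have hprim : (fun t ↦ ∫ x, k (t - x) * G x) = fun t ↦
      (∫ x, k (0 - x) * G x) + ∫ s in (0 : ℝ)..t, ∫ x, k' (s - x) * G x := by
    ext t
    have hfub : ∫ s in (0 : ℝ)..t, ∫ x, k' (s - x) * G x =
        ∫ x, ∫ s in (0 : ℝ)..t, k' (s - x) * G x := by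
      refine intervalIntegral_integral_swap ?_
      have hmeas : Measurable fun z : ℝ × ℝ ↦ k' (z.1 - z.2) * G z.2 :=
        (hk'm.comp (measurable_fst.sub measurable_snd)).mul
          (hGm.comp measurable_snd)
      refine (integrable_prod_iff hmeas.aestronglyMeasurable).2 ?_
      refine ⟨Eventually.of_forall fun s ↦ hint2 s, ?_⟩
      have hc : Continuous fun s ↦ ∫ x, |k'| (s - x) * |G| x := by
        refine continuous_integral_comp_sub_mul hk.abs hGm.abs (M := M) (fun x ↦ ?_)
          (hG.mono fun x (hx : ¬ContinuousAt |G| x) (hcx : ContinuousAt G x) ↦ hx hcx.abs)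
        simpa using hM x
      have : (fun s ↦ ∫ x, ‖k' (s - x) * G x‖) = fun s ↦ ∫ x, |k'| (s - x) * |G| x := by
        ext s; simp
      rw [this]
      exact hc.integrableOn_uIoc
    rw [hfub, ← integral_add (hint1 0)]
    · refine integral_congr_ae (Eventually.of_forall fun x ↦ ?_)
      simp only
      rw [intervalIntegral.integral_mul_const,
        intervalIntegral.integral_comp_sub_right k' x,
        hkk']
      ring
    · refine ((hint1 t).sub (hint1 0)).congr (Eventually.of_forall fun x ↦ ?_)
      simp only [Pi.sub_apply]
      rw [intervalIntegral.integral_mul_const,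
        intervalIntegral.integral_comp_sub_right k' x,
        hkk']
      ring
  rw [hprim]
  exact (intervalIntegral.integral_hasDerivAt_right (hcont.intervalIntegrable _ _)
    (hcont.stronglyMeasurableAtFilter _ _) hcont.continuousAt).const_add _

/-! ### Kernel smooths -/

lemma integrable_comp_sub_div {g : ℝ → ℝ} (hg : Integrable g) {h : ℝ} (hh : 0 < h) (t : ℝ) :
    Integrable fun x ↦ g ((t - x) / h) :=
  (hg.comp_div hh.ne').comp_sub_left t

lemma integral_comp_sub_div (g : ℝ → ℝ) {h : ℝ} (hh : 0 < h) (t : ℝ) :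
    ∫ x, g ((t - x) / h) = h * ∫ x, g x := by
  rw [integral_sub_left_eq_self (fun x ↦ g (x / h)) volume t, Measure.integral_comp_div,
    abs_of_pos hh, smul_eq_mul]

section Smooth

variable {a b h : ℝ} {K G H : ℝ → ℝ}

/-- Integration by parts; its minus sign cancels the one from differentiating `(t - x) / h` in `x`.
-/
lemma kernelSmooth_eq (hK : IsKernel K) (hK' : HasIntegrableDerivatives K) (hh : 0 < h)
    (hG : BoundedVariationOn (extendConst a b G) univ) (t : ℝ) :
    kernelSmooth a b K h G t =
      (h ^ 2)⁻¹ * ∫ x, deriv K ((t - x) / h) * extendConst a b G x := by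
  have hd : ∀ x, HasDerivAt (fun x ↦ K ((t - x) / h)) (-h⁻¹ * deriv K ((t - x) / h)) x := by
    intro x
    have h1 : HasDerivAt (fun x : ℝ ↦ (t - x) / h) (-1 / h) x :=
      ((hasDerivAt_id x).const_sub t).div_const h
    have := (hK'.differentiable ((t - x) / h)).hasDerivAt.comp x h1
    convert! this using 1
    ring
  have hderiv : deriv (fun x ↦ K ((t - x) / h)) = fun x ↦ -h⁻¹ * deriv K ((t - x) / h) :=
    funext fun x ↦ (hd x).deriv
  have hsupp : HasCompactSupport fun x ↦ K ((t - x) / h) := by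
    refine HasCompactSupport.intro (isCompact_Icc (a := t - h) (b := t + h)) fun x hx ↦ ?_
    by_contra hne
    have := hK.support_subset (Function.mem_support.2 hne)
    rw [mem_Icc, le_div_iff₀ hh, div_le_iff₀ hh] at this
    exact hx ⟨by linarith, by linarith⟩
  have hi : Integrable (deriv fun x ↦ K ((t - x) / h)) := by
    rw [hderiv]
    exact (integrable_comp_sub_div hK'.integrable_deriv hh t).const_mul _
  rw [kernelSmooth, stieltjesIntegral, dif_pos hG,
    hG.integral_vectorMeasure_eq (fun x ↦ (hd x).differentiableAt) hi hsupp, hderiv]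
  simp only [mul_assoc]
  rw [integral_const_mul]
  ring

lemma hasDerivAt_kernelSmooth (hK : IsKernel K) (hK' : HasIntegrableDerivatives K) (hh : 0 < h)
    (hG : BoundedVariationOn (extendConst a b G) univ) (t : ℝ) :
    HasDerivAt (kernelSmooth a b K h G)
      ((h ^ 3)⁻¹ * ∫ x, deriv (deriv K) ((t - x) / h) * extendConst a b G x) t := by
  obtain ⟨M, hM⟩ := hG.exists_abs_le
  have hGm := measurable_of_countable_not_continuousAt hG.countable_not_continuousAt
  rw [funext (kernelSmooth_eq hK hK' hh hG)]
  have := hasDerivAt_integral_comp_sub_mul (k := fun s ↦ deriv K (s / h))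
    (k' := fun s ↦ h⁻¹ * deriv (deriv K) (s / h)) (G := extendConst a b G) ?_
    (hK'.integrable_deriv.comp_div hh.ne')
    ((hK'.integrable_deriv_deriv.comp_div hh.ne').const_mul _)
    (((measurable_deriv _).comp (measurable_id.div_const h)).const_mul _)
    hGm hM hG.countable_not_continuousAt t
  · convert! this.const_mul (h ^ 2)⁻¹ using 1
    simp only [mul_assoc]
    rw [integral_const_mul]
    field_simp
  · intro x y
    rw [intervalIntegral.integral_const_mul, intervalIntegral.integral_comp_div _ hh.ne',
      (hK'.absolutelyContinuous _ _).integral_deriv_eq_sub, smul_eq_mul,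
      inv_mul_cancel_left₀ hh.ne']

/-- Constant extension evaluates only at points of `[a,b]`, so the bound `D` is valid on all of `ℝ`;
the factor `h` is the change of variables. -/
lemma abs_integral_comp_sub_div_mul_sub_le {g : ℝ → ℝ} (hg : Integrable g) (hh : 0 < h)
    (hab : a ≤ b) (hG : BoundedVariationOn (extendConst a b G) univ)
    (hH : BoundedVariationOn (extendConst a b H) univ) {D : ℝ}
    (hD : ∀ x ∈ Icc a b, |H x - G x| ≤ D) (t : ℝ) :
    |(∫ x, g ((t - x) / h) * extendConst a b H x) - ∫ x, g ((t - x) / h) * extendConst a b G x| ≤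
      h * (∫ u, |g u|) * D := by
  have hint : ∀ {G}, BoundedVariationOn (extendConst a b G) univ →
      Integrable fun x ↦ g ((t - x) / h) * extendConst a b G x := by
    intro G hG
    obtain ⟨M, hM⟩ := hG.exists_abs_le
    exact (integrable_comp_sub_div hg hh t).mul_bdd (c := M)
      (measurable_of_countable_not_continuousAt hG.countable_not_continuousAt).aestronglyMeasurable
      (Eventually.of_forall hM)
  rw [← integral_sub (hint hH) (hint hG), ← integral_comp_sub_div (fun u ↦ |g u|) hh t,
    ← integral_mul_const]
  refine norm_integral_le_of_norm_le (f := fun x ↦ g ((t - x) / h) * extendConst a b H x -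
    g ((t - x) / h) * extendConst a b G x)
    ((integrable_comp_sub_div hg.abs hh t).mul_const D) (Eventually.of_forall fun x ↦ ?_)
  rw [← mul_sub, norm_mul]
  exact mul_le_mul_of_nonneg_left
    (hD _ ⟨le_max_left _ _, max_le hab (min_le_left _ _)⟩) (norm_nonneg _)

lemma abs_kernelSmooth_sub_le (hK : IsKernel K) (hK' : HasIntegrableDerivatives K) (hh : 0 < h)
    (hab : a ≤ b) (hG : BoundedVariationOn (extendConst a b G) univ)
    (hH : BoundedVariationOn (extendConst a b H) univ) {D : ℝ}
    (hD : ∀ x ∈ Icc a b, |H x - G x| ≤ D) (t : ℝ) :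
    |kernelSmooth a b K h H t - kernelSmooth a b K h G t| ≤ h⁻¹ * (∫ u, |deriv K u|) * D := by
  rw [kernelSmooth_eq hK hK' hh hG, kernelSmooth_eq hK hK' hh hH, ← mul_sub, abs_mul,
    abs_of_pos (by positivity)]
  refine (mul_le_mul_of_nonneg_left (abs_integral_comp_sub_div_mul_sub_le hK'.integrable_deriv hh
    hab hG hH hD t) (by positivity)).trans_eq ?_
  field_simp

lemma abs_deriv_kernelSmooth_sub_le (hK : IsKernel K) (hK' : HasIntegrableDerivatives K)
    (hh : 0 < h) (hab : a ≤ b) (hG : BoundedVariationOn (extendConst a b G) univ)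
    (hH : BoundedVariationOn (extendConst a b H) univ) {D : ℝ}
    (hD : ∀ x ∈ Icc a b, |H x - G x| ≤ D) (t : ℝ) :
    |deriv (kernelSmooth a b K h H) t - deriv (kernelSmooth a b K h G) t| ≤
      (h ^ 2)⁻¹ * (∫ u, |deriv (deriv K) u|) * D := by
  rw [(hasDerivAt_kernelSmooth hK hK' hh hG t).deriv, (hasDerivAt_kernelSmooth hK hK' hh hH t).deriv,
    ← mul_sub, abs_mul, abs_of_pos (by positivity)]
  refine (mul_le_mul_of_nonneg_left (abs_integral_comp_sub_div_mul_sub_le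
    hK'.integrable_deriv_deriv hh hab hG hH hD t) (by positivity)).trans_eq ?_
  field_simp

/-! ### Kernel estimators with linear boundary extension -/

/-- The three cases are one formula: the tangent line at the projection of `t` to `[a+h, b-h]`,
evaluated at `t`. -/
lemma kernelEstimator_eq_clamp (hle : 2 * h ≤ b - a) (t : ℝ) :
    kernelEstimator a b K h G t =
      kernelSmooth a b K h G (max (a + h) (min (b - h) t)) +
        deriv (kernelSmooth a b K h G) (max (a + h) (min (b - h) t)) *
          (t - max (a + h) (min (b - h) t)) := by
  unfold kernelEstimator
  split_ifs with h1 h2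
  · rw [min_eq_right (by linarith), max_eq_left h1.le, sub_add_eq_sub_sub]
  · rw [min_eq_right h2, max_eq_right (not_lt.1 h1)]
    ring
  · rw [min_eq_left (not_le.1 h2).le, max_eq_right (by linarith)]
    ring

lemma HasDerivAt.of_Iic_of_Ici {g u v : ℝ → ℝ} {p d : ℝ} (hu : HasDerivAt u d p)
    (hv : HasDerivAt v d p) (hgu : ∀ x ≤ p, g x = u x) (hgv : ∀ x ≥ p, g x = v x) :
    HasDerivAt g d p := by
  have h1 : HasDerivWithinAt g d (Iic p) p :=
    hu.hasDerivWithinAt.congr (fun x hx ↦ hgu x hx) (hgu p le_rfl)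
  have h2 : HasDerivWithinAt g d (Ici p) p :=
    hv.hasDerivWithinAt.congr (fun x hx ↦ hgv x hx) (hgv p le_rfl)
  have := h1.union h2
  rwa [Iic_union_Ici, hasDerivWithinAt_univ] at this

/-- A differentiable function continued by its tangent lines outside `[p,q]` is differentiable. -/
lemma hasDerivAt_tangent_extension {S : ℝ → ℝ} (hS : Differentiable ℝ S) {p q : ℝ} (hpq : p ≤ q)
    (t : ℝ) :
    HasDerivAt (fun t ↦ S (max p (min q t)) + deriv S (max p (min q t)) * (t - max p (min q t)))
      (deriv S (max p (min q t))) t := by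
  have htan : ∀ c x : ℝ, HasDerivAt (fun t ↦ S c + deriv S c * (t - c)) (deriv S c) x := by
    intro c x
    simpa using (((hasDerivAt_id x).sub_const c).const_mul (deriv S c)).const_add (S c)
  have hl : ∀ x ≤ p, max p (min q x) = p := fun x hx ↦ by
    rw [min_eq_right (hx.trans hpq), max_eq_left hx]
  have hm : ∀ x, p ≤ x → x ≤ q → max p (min q x) = x := fun x h1 h2 ↦ by
    rw [min_eq_right h2, max_eq_right h1]
  have hr : ∀ x, q ≤ x → max p (min q x) = q := fun x hx ↦ by
    rw [min_eq_left hx, max_eq_right hpq]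
  rcases lt_trichotomy t p with h1 | rfl | h1
  · rw [hl t h1.le]
    refine (htan p t).congr_of_eventuallyEq ?_
    filter_upwards [Iio_mem_nhds h1] with x hx
    rw [hl x (le_of_lt hx)]
  · rcases hpq.eq_or_lt with rfl | hlt
    -- The interval has collapsed to a point, and the extension is a single tangent line.
    · have hc : ∀ x, max t (min t x) = t := fun x ↦ max_eq_left (min_le_left _ _)
      simp only [hc]
      exact htan t t
    · rw [hl t le_rfl]
      have hloc : HasDerivAt (fun x ↦ if x ≤ t then S t + deriv S t * (x - t) else S x)
          (deriv S t) t := by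
        refine HasDerivAt.of_Iic_of_Ici (htan t t) (hS t).hasDerivAt
          (fun x hx ↦ if_pos hx) fun x hx ↦ ?_
        split_ifs with h
        · rw [le_antisymm h hx]; ring
        · rfl
      refine hloc.congr_of_eventuallyEq ?_
      filter_upwards [Iio_mem_nhds hlt] with x hx
      split_ifs with h
      · rw [hl x h]
      · rw [hm x (not_le.1 h).le (le_of_lt hx)]; ring
  · rcases lt_trichotomy t q with h2 | rfl | h2
    · rw [hm t h1.le h2.le]
      refine (hS t).hasDerivAt.congr_of_eventuallyEq ?_
      filter_upwards [Ioo_mem_nhds h1 h2] with x hx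
      rw [hm x hx.1.le hx.2.le]; ring
    · rw [hr t le_rfl]
      have hloc : HasDerivAt (fun x ↦ if x ≤ t then S x else S t + deriv S t * (x - t))
          (deriv S t) t := by
        refine HasDerivAt.of_Iic_of_Ici (hS t).hasDerivAt (htan t t)
          (fun x hx ↦ if_pos hx) fun x hx ↦ ?_
        split_ifs with h
        · rw [le_antisymm h hx]; ring
        · rfl
      refine hloc.congr_of_eventuallyEq ?_
      filter_upwards [Ioi_mem_nhds h1] with x hx
      split_ifs with h
      · rw [hm x (le_of_lt hx) h]; ring
      · rw [hr x (not_le.1 h).le]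
    · rw [hr t h2.le]
      refine (htan q t).congr_of_eventuallyEq ?_
      filter_upwards [Ioi_mem_nhds h2] with x hx
      rw [hr x (le_of_lt hx)]

lemma hasDerivAt_kernelEstimator (hK : IsKernel K) (hK' : HasIntegrableDerivatives K)
    (hh : 0 < h) (hle : 2 * h ≤ b - a) (hG : BoundedVariationOn (extendConst a b G) univ) (t : ℝ) :
    HasDerivAt (kernelEstimator a b K h G)
      (deriv (kernelSmooth a b K h G) (max (a + h) (min (b - h) t))) t := by
  rw [funext (kernelEstimator_eq_clamp hle)]
  exact hasDerivAt_tangent_extension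
    (fun x ↦ (hasDerivAt_kernelSmooth hK hK' hh hG x).differentiableAt) (by linarith) t

lemma abs_sub_clamp_le (hh : 0 < h) (hle : 2 * h ≤ b - a) {t : ℝ} (ht : t ∈ Icc a b) :
    |t - max (a + h) (min (b - h) t)| ≤ h := by
  obtain ⟨h1, h2⟩ := ht
  rw [abs_le]
  rcases max_cases (a + h) (min (b - h) t) with h3 | h3 <;>
  rcases min_cases (b - h) t with h4 | h4 <;> constructor <;> linarith

/-- The derivative difference carries an extra `h⁻¹`, which the distance from `t` to its projection,
at most `h`, compensates. -/
lemma abs_kernelEstimator_sub_le (hK : IsKernel K) (hK' : HasIntegrableDerivatives K) (hh : 0 < h)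
    (hle : 2 * h ≤ b - a) (hG : BoundedVariationOn (extendConst a b G) univ)
    (hH : BoundedVariationOn (extendConst a b H) univ) {D : ℝ}
    (hD : ∀ x ∈ Icc a b, |H x - G x| ≤ D) {t : ℝ} (ht : t ∈ Icc a b) :
    |kernelEstimator a b K h H t - kernelEstimator a b K h G t| ≤
      ((∫ u, |deriv K u|) + ∫ u, |deriv (deriv K) u|) * D * h⁻¹ := by
  have hab : a ≤ b := by linarith
  rw [kernelEstimator_eq_clamp hle, kernelEstimator_eq_clamp hle]
  set c := max (a + h) (min (b - h) t) with hc
  have h1 := abs_kernelSmooth_sub_le hK hK' hh hab hG hH hD c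
  have h2 := abs_deriv_kernelSmooth_sub_le hK hK' hh hab hG hH hD c
  have h3 := abs_sub_clamp_le hh hle ht
  have h4 : |(deriv (kernelSmooth a b K h H) c - deriv (kernelSmooth a b K h G) c) * (t - c)| ≤
      ((h ^ 2)⁻¹ * (∫ u, |deriv (deriv K) u|) * D) * h := by
    rw [abs_mul]
    exact mul_le_mul h2 h3 (abs_nonneg _) ((abs_nonneg _).trans h2)
  calc _ = |(kernelSmooth a b K h H c - kernelSmooth a b K h G c) +
        (deriv (kernelSmooth a b K h H) c - deriv (kernelSmooth a b K h G) c) * (t - c)| := by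
        congr 1; ring
    _ ≤ _ := (abs_add_le _ _).trans (add_le_add h1 h4)
    _ = _ := by field_simp

lemma derivWithin_kernelEstimator (hK : IsKernel K) (hK' : HasIntegrableDerivatives K)
    (hh : 0 < h) (hle : 2 * h ≤ b - a) (hG : BoundedVariationOn (extendConst a b G) univ)
    {t : ℝ} (ht : t ∈ Icc a b) :
    derivWithin (kernelEstimator a b K h G) (Icc a b) t =
      deriv (kernelSmooth a b K h G) (max (a + h) (min (b - h) t)) :=
  (hasDerivAt_kernelEstimator hK hK' hh hle hG t).hasDerivWithinAt.derivWithin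
    (uniqueDiffOn_Icc (by linarith) t ht)

lemma abs_iteratedDerivWithin_kernelEstimator_sub_le (hK : IsKernel K)
    (hK' : HasIntegrableDerivatives K) (hh : 0 < h)
    (hle : 2 * h ≤ b - a) (hG : BoundedVariationOn (extendConst a b G) univ)
    (hH : BoundedVariationOn (extendConst a b H) univ) {D : ℝ}
    (hD : ∀ x ∈ Icc a b, |H x - G x| ≤ D) {l : ℕ} (hl : l ≤ 1) {t : ℝ} (ht : t ∈ Icc a b) :
    |iteratedDerivWithin l (kernelEstimator a b K h H) (Icc a b) t -
      iteratedDerivWithin l (kernelEstimator a b K h G) (Icc a b) t| ≤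
      ((∫ u, |deriv K u|) + ∫ u, |deriv (deriv K) u|) * D * (h ^ (1 + l))⁻¹ := by
  have hD0 : 0 ≤ D := (abs_nonneg _).trans (hD t ht)
  interval_cases l
  · simpa using abs_kernelEstimator_sub_le hK hK' hh hle hG hH hD ht
  · rw [iteratedDerivWithin_one, iteratedDerivWithin_one,
      derivWithin_kernelEstimator hK hK' hh hle hG ht,
      derivWithin_kernelEstimator hK hK' hh hle hH ht]
    refine (abs_deriv_kernelSmooth_sub_le hK hK' hh (by linarith) hG hH hD _).trans ?_
    have h0 : 0 ≤ ∫ u, |deriv K u| := integral_nonneg fun _ ↦ abs_nonneg _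
    have : 0 ≤ (∫ u, |deriv K u|) * D * (h ^ 2)⁻¹ := by positivity
    norm_num
    linarith

end Smooth

/-! ### Chaining along refined grids -/

section Chaining

variable {g : ℝ → ℝ} {N : ℕ} {T : ℝ}

/-- The left neighbour of `x` in the grid of mesh `1 / (N 2 ^ m)`. -/
noncomputable def gridFloor (N m : ℕ) (x : ℝ) : ℝ := (⌊x * (N * 2 ^ m)⌋₊ : ℝ) / (N * 2 ^ m)

lemma gridFloor_mem (hN : 0 < N) (m : ℕ) {x : ℝ} (hx : x ∈ Icc (0 : ℝ) 1) :
    gridFloor N m x ∈ Icc (0 : ℝ) 1 ∧ gridFloor N m x ≤ x ∧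
      x < gridFloor N m x + 1 / (N * 2 ^ m) := by
  have hN' : (0 : ℝ) < N * 2 ^ m := by positivity
  have h1 : gridFloor N m x ≤ x := by
    rw [gridFloor, div_le_iff₀ hN']
    exact Nat.floor_le (mul_nonneg hx.1 hN'.le)
  refine ⟨⟨by unfold gridFloor; positivity, h1.trans hx.2⟩, h1, ?_⟩
  rw [gridFloor, ← add_div, lt_div_iff₀ hN']
  exact Nat.lt_floor_add_one _

lemma tendsto_gridFloor (hN : 0 < N) {x : ℝ} (hx : x ∈ Icc (0 : ℝ) 1) :
    Tendsto (fun m ↦ gridFloor N m x) atTop (𝓝 x) := by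
  have h0 : Tendsto (fun m : ℕ ↦ x - (1 / 2 : ℝ) ^ m) atTop (𝓝 x) := by
    simpa using (tendsto_pow_atTop_nhds_zero_of_lt_one (r := (1 / 2 : ℝ)) (by norm_num)
      (by norm_num)).const_sub x
  refine tendsto_of_tendsto_of_tendsto_of_le_of_le h0 tendsto_const_nhds (fun m ↦ ?_)
    fun m ↦ (gridFloor_mem hN m hx).2.1
  have h1 := (gridFloor_mem hN m hx).2.2
  have h2 : (1 : ℝ) / (N * 2 ^ m) ≤ (1 / 2) ^ m := by
    rw [one_div_pow]
    refine one_div_le_one_div_of_le (by positivity) ?_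
    have : (1 : ℝ) ≤ N := by exact_mod_cast hN
    nlinarith [pow_pos (two_pos : (0 : ℝ) < 2) m]
  simp only
  linarith

/-- `⌊2y⌋` is `2⌊y⌋` or `2⌊y⌋ + 1`, so halving the mesh moves the left neighbour by at most one fine
cell. -/
lemma abs_gridFloor_succ_sub_le (hN : 0 < N) (hT : 0 ≤ T)
    (hstep : ∀ m j : ℕ, j < N * 2 ^ m →
      |g ((j + 1) / (N * 2 ^ m)) - g (j / (N * 2 ^ m))| ≤ T * (3 / 4) ^ m)
    (m : ℕ) {x : ℝ} (hx : x ∈ Icc (0 : ℝ) 1) :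
    |g (gridFloor N (m + 1) x) - g (gridFloor N m x)| ≤ T * (3 / 4) ^ (m + 1) := by
  have hN' : (0 : ℝ) < N * 2 ^ m := by positivity
  set y := x * (N * 2 ^ m) with hy
  have hy0 : 0 ≤ y := mul_nonneg hx.1 hN'.le
  have hy2 : x * (N * 2 ^ (m + 1)) = 2 * y := by rw [hy, pow_succ]; ring
  set k := ⌊y⌋₊ with hk
  have e1 : gridFloor N m x = ((2 * k : ℕ) : ℝ) / (N * 2 ^ (m + 1)) := by
    rw [gridFloor, ← hy, ← hk, pow_succ]; push_cast; field_simp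
  have e2 : gridFloor N (m + 1) x = (⌊2 * y⌋₊ : ℝ) / (N * 2 ^ (m + 1)) := by
    rw [gridFloor, hy2]
  have hk1 : (k : ℝ) ≤ y := Nat.floor_le hy0
  have hk2 : y < k + 1 := Nat.lt_floor_add_one y
  rw [e1, e2]
  rcases lt_or_ge (2 * y) (2 * k + 1) with h | h
  · have : ⌊2 * y⌋₊ = 2 * k := by
      rw [Nat.floor_eq_iff (by positivity)]
      push_cast
      exact ⟨by linarith, h⟩
    rw [this, sub_self, abs_zero]
    positivity
  · have : ⌊2 * y⌋₊ = 2 * k + 1 := by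
      rw [Nat.floor_eq_iff (by positivity)]
      push_cast
      exact ⟨h, by linarith⟩
    rw [this]
    push_cast
    have hj : 2 * k < N * 2 ^ (m + 1) := by
      have h1 : (2 * k + 1 : ℝ) ≤ N * 2 ^ (m + 1) := by
        refine h.trans ?_
        rw [← hy2]
        exact mul_le_of_le_one_left (by positivity) hx.2
      exact_mod_cast h1
    have := hstep (m + 1) (2 * k) hj
    push_cast at this
    exact this

lemma abs_sub_gridFloor_zero_le (hN : 0 < N) (hT : 0 ≤ T) (hg : ContinuousOn g (Icc 0 1))
    (hstep : ∀ m j : ℕ, j < N * 2 ^ m →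
      |g ((j + 1) / (N * 2 ^ m)) - g (j / (N * 2 ^ m))| ≤ T * (3 / 4) ^ m)
    {x : ℝ} (hx : x ∈ Icc (0 : ℝ) 1) : |g x - g (gridFloor N 0 x)| ≤ 3 * T := by
  -- The right side is the partial sum of `T (3/4)^i` over `1 ≤ i ≤ m`; continuity of `g` then lets
  -- `m → ∞`.
  have h1 : ∀ m, |g (gridFloor N m x) - g (gridFloor N 0 x)| ≤ 3 * T * (1 - (3 / 4) ^ m) := by
    intro m
    induction m with
    | zero => simp
    | succ m ih =>
      have h := abs_gridFloor_succ_sub_le hN hT hstep m hx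
      calc _ ≤ _ := abs_sub_le _ (g (gridFloor N m x)) _
        _ ≤ T * (3 / 4) ^ (m + 1) + 3 * T * (1 - (3 / 4) ^ m) := add_le_add h ih
        _ = _ := by rw [pow_succ]; ring
  have h2 : Tendsto (fun m ↦ |g (gridFloor N m x) - g (gridFloor N 0 x)|) atTop
      (𝓝 |g x - g (gridFloor N 0 x)|) := by
    have h3 : Tendsto (fun m ↦ gridFloor N m x) atTop (𝓝[Icc 0 1] x) :=
      tendsto_nhdsWithin_iff.2 ⟨tendsto_gridFloor hN hx,
        Eventually.of_forall fun m ↦ (gridFloor_mem hN m hx).1⟩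
    exact (((hg x hx).tendsto.comp h3).sub_const _).abs
  refine le_of_tendsto h2 (Eventually.of_forall fun m ↦ (h1 m).trans ?_)
  have : (0 : ℝ) ≤ (3 / 4) ^ m := by positivity
  nlinarith

/-- A continuous function whose increments over the `m`-th refinement of a grid of mesh `1 / N` are
at most `T (3 / 4) ^ m` oscillates by at most `7 T` over a mesh. -/
lemma abs_sub_le_of_grid_increments (hN : 0 < N) (hT : 0 ≤ T) (hg : ContinuousOn g (Icc 0 1))
    (hstep : ∀ m j : ℕ, j < N * 2 ^ m →
      |g ((j + 1) / (N * 2 ^ m)) - g (j / (N * 2 ^ m))| ≤ T * (3 / 4) ^ m)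
    {x y : ℝ} (hx : x ∈ Icc (0 : ℝ) 1) (hy : y ∈ Icc (0 : ℝ) 1) :
    |g x - g y| ≤ 7 * T + T * N * |x - y| := by
  wlog hxy : x ≤ y generalizing x y
  · rw [abs_sub_comm (g x), abs_sub_comm x]
    exact this hy hx (not_le.1 hxy).le
  have hN' : (0 : ℝ) < N := by exact_mod_cast hN
  have hgrid : ∀ i k : ℕ, i + k ≤ N → |g ((i + k : ℕ) / N) - g (i / N)| ≤ T * k := by
    intro i k
    induction k with
    | zero => intro; simp
    | succ k ih =>
      intro hk
      have h1 := ih (by omega)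
      have h2 := hstep 0 (i + k) (by simp; omega)
      simp only [pow_zero, mul_one] at h2
      calc _ ≤ _ := abs_sub_le _ (g ((i + k : ℕ) / N)) _
        _ ≤ T + T * k := by
            refine add_le_add ?_ h1
            rwa [← add_assoc, Nat.cast_succ]
        _ = _ := by push_cast; ring
  set i := ⌊x * N⌋₊ with hi
  set k := ⌊y * N⌋₊ with hk
  have hik : i ≤ k := Nat.floor_le_floor (by gcongr)
  have hkN : k ≤ N := by
    refine Nat.floor_le_of_le ?_
    exact mul_le_of_le_one_left hN'.le hy.2
  have h0 : |g (k / N) - g (i / N)| ≤ T * ((k : ℝ) - i) := by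
    have := hgrid i (k - i) (by omega)
    rwa [Nat.add_sub_cancel' hik, Nat.cast_sub hik] at this
  have hxf : gridFloor N 0 x = i / N := by simp [gridFloor, hi]
  have hyf : gridFloor N 0 y = k / N := by simp [gridFloor, hk]
  have h1 := abs_sub_gridFloor_zero_le hN hT hg hstep hx
  have h2 := abs_sub_gridFloor_zero_le hN hT hg hstep hy
  rw [hxf] at h1
  rw [hyf] at h2
  -- The constant `7` is `3 + 3` for the two chains down to the coarse grid, plus `1` for the extra
  -- cell caused by rounding here.
  have h3 : (k : ℝ) - i ≤ N * |x - y| + 1 := by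
    have e1 : (k : ℝ) ≤ y * N := Nat.floor_le (mul_nonneg hy.1 hN'.le)
    have e2 : x * N < i + 1 := Nat.lt_floor_add_one _
    rw [abs_of_nonpos (by linarith)]
    linarith
  have h4 := mul_le_mul_of_nonneg_left h3 hT
  rw [abs_le] at h0 h1 h2 ⊢
  constructor <;> linarith

end Chaining

/-! ### Gaussian increments -/

section Gaussian

variable {Ω : Type*} [MeasurableSpace Ω] {P : Measure Ω}

/-- Chernoff bound for both tails. An upper bound `v` on the variance suffices, which is what admits
the bridge. -/
lemma measure_abs_ge_le_of_hasGaussianLaw [IsProbabilityMeasure P] {X : Ω → ℝ}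
    (hX : HasGaussianLaw X P)
    (h0 : ∫ ω, X ω ∂P = 0) {v : ℝ} (hv : Var[X; P] ≤ v) {x : ℝ} (hx : 0 ≤ x) :
    P {ω | x ≤ |X ω|} ≤ ENNReal.ofReal (2 * Real.exp (-x ^ 2 / (2 * v))) := by
  have hv0 : 0 ≤ v := (variance_nonneg X P).trans hv
  have hmap := hX.map_eq_gaussianReal
  rw [h0] at hmap
  have hsub : HasSubgaussianMGF X v.toNNReal P := by
    refine ⟨fun t ↦ ?_, fun t ↦ ?_⟩
    · have h1 : Integrable (fun x : ℝ ↦ Real.exp (t * x)) (P.map X) := by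
        rw [hmap]; exact integrable_exp_mul_gaussianReal t
      exact h1.comp_aemeasurable hX.aemeasurable
    · rw [mgf_gaussianReal hmap, zero_mul, zero_add, Real.coe_toNNReal _ (variance_nonneg _ _),
        Real.coe_toNNReal _ hv0]
      gcongr
  have h1 := hsub.measure_ge_le hx
  have h2 := hsub.neg.measure_ge_le hx
  rw [Real.coe_toNNReal _ hv0] at h1 h2
  have hsplit : {ω | x ≤ |X ω|} ⊆ {ω | x ≤ X ω} ∪ {ω | x ≤ (-X) ω} := fun ω (hω : x ≤ |X ω|) ↦
    le_abs.1 hω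
  have hreal : P.real {ω | x ≤ |X ω|} ≤ 2 * Real.exp (-x ^ 2 / (2 * v)) :=
    (measureReal_mono hsplit).trans ((measureReal_union_le _ _).trans (by linarith))
  rw [← ofReal_measureReal]
  exact ENNReal.ofReal_le_ofReal hreal

/-- Tail bound for the increments of a centred Gaussian process, when their variance is at most that
of the increments of a Brownian motion. -/
lemma IsGaussianProcess.measure_abs_sub_ge_le [IsProbabilityMeasure P] {I : Set ℝ} {B : ℝ → Ω → ℝ}
    (hG : IsGaussianProcess (fun t : I ↦ B t) P) (h0 : ∀ t ∈ I, ∫ ω, B t ω ∂P = 0)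
    {s t : ℝ} (hs : s ∈ I) (ht : t ∈ I)
    (hcov : cov[B s, B s; P] - 2 * cov[B s, B t; P] + cov[B t, B t; P] ≤ |s - t|)
    {x : ℝ} (hx : 0 ≤ x) :
    P {ω | x ≤ |B s ω - B t ω|} ≤ ENNReal.ofReal (2 * Real.exp (-x ^ 2 / (2 * |s - t|))) := by
  have hs' := hG.hasGaussianLaw_eval ⟨s, hs⟩
  have ht' := hG.hasGaussianLaw_eval ⟨t, ht⟩
  have hst : HasGaussianLaw (fun ω ↦ B s ω - B t ω) P :=
    hG.hasGaussianLaw_fun_sub (s := ⟨s, hs⟩) (t := ⟨t, ht⟩)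
  refine measure_abs_ge_le_of_hasGaussianLaw hst ?_ ?_ hx
  · rw [integral_sub hs'.integrable ht'.integrable]
    simp [h0 s hs, h0 t ht]
  · rw [variance_fun_sub hs'.memLp_two ht'.memLp_two]
    rw [covariance_self hs'.aemeasurable, covariance_self ht'.aemeasurable] at hcov
    exact hcov

lemma IsBrownianMotionOn.measure_abs_sub_ge_le [IsProbabilityMeasure P] {I : Set ℝ}
    {B : ℝ → Ω → ℝ} (hB : IsBrownianMotionOn I B P) {s t : ℝ} (hs : s ∈ I) (ht : t ∈ I)
    {x : ℝ} (hx : 0 ≤ x) :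
    P {ω | x ≤ |B s ω - B t ω|} ≤ ENNReal.ofReal (2 * Real.exp (-x ^ 2 / (2 * |s - t|))) := by
  refine IsGaussianProcess.measure_abs_sub_ge_le hB.isGaussianProcess hB.integral_eq_zero hs ht
    ?_ hx
  rw [hB.covariance_eq s hs s hs, hB.covariance_eq s hs t ht, hB.covariance_eq t ht t ht]
  simp only [sub_self, abs_zero]
  linarith

/-- The increment has variance `|s-t| - (s-t)²`, below that of Brownian motion. -/
lemma IsBrownianBridgeOn.measure_abs_sub_ge_le [IsProbabilityMeasure P] {I : Set ℝ}
    {B : ℝ → Ω → ℝ} (hB : IsBrownianBridgeOn I B P) {s t : ℝ} (hs : s ∈ I) (ht : t ∈ I)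
    {x : ℝ} (hx : 0 ≤ x) :
    P {ω | x ≤ |B s ω - B t ω|} ≤ ENNReal.ofReal (2 * Real.exp (-x ^ 2 / (2 * |s - t|))) := by
  refine IsGaussianProcess.measure_abs_sub_ge_le hB.isGaussianProcess hB.integral_eq_zero hs ht
    ?_ hx
  rw [hB.covariance_eq s hs s hs, hB.covariance_eq s hs t ht, hB.covariance_eq t ht t ht,
    min_self, min_self]
  rcases le_total s t with h | h
  · rw [min_eq_left h, abs_of_nonpos (by linarith)]
    nlinarith [sq_nonneg (s - t)]
  · rw [min_eq_right h, abs_of_nonneg (by linarith)]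
    nlinarith [sq_nonneg (s - t)]

/-- The grid increments of a process with Gaussian increments on `[p, p + ℓ]` exceed the thresholds
used in chaining with small probability. -/
lemma measure_exists_grid_increment_gt_le {p ℓ lam : ℝ} (hℓ : 0 < ℓ) (hlam : 1 ≤ lam) {N : ℕ}
    (hN : 0 < N) {B : ℝ → Ω → ℝ}
    (hB : ∀ s ∈ Icc p (p + ℓ), ∀ t ∈ Icc p (p + ℓ), ∀ x : ℝ, 0 ≤ x →
      P {ω | x ≤ |B s ω - B t ω|} ≤ ENNReal.ofReal (2 * Real.exp (-x ^ 2 / (2 * |s - t|)))) :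
    P {ω | ∃ m j : ℕ, j < N * 2 ^ m ∧ 8 * √(ℓ * lam / N) * (3 / 4) ^ m <
      |B (p + ℓ * ((j + 1) / (N * 2 ^ m))) ω - B (p + ℓ * (j / (N * 2 ^ m))) ω|} ≤
    ENNReal.ofReal (4 * N * Real.exp (-2 * lam)) := by
  have hN' : (0 : ℝ) < N := by exact_mod_cast hN
  set T := 8 * √(ℓ * lam / N) with hT
  have hT2 : T ^ 2 = 64 * (ℓ * lam / N) := by
    rw [hT, mul_pow, Real.sq_sqrt (by positivity)]; norm_num
  set E : ℕ → ℕ → Set Ω := fun m j ↦ {ω | T * (3 / 4) ^ m ≤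
      |B (p + ℓ * ((j + 1) / (N * 2 ^ m))) ω - B (p + ℓ * (j / (N * 2 ^ m))) ω|} with hE
  have hmem : ∀ m j : ℕ, j ≤ N * 2 ^ m → p + ℓ * (j / (N * 2 ^ m)) ∈ Icc p (p + ℓ) := by
    intro m j hj
    have hj' : (j : ℝ) ≤ N * 2 ^ m := by exact_mod_cast hj
    have h1 : (j : ℝ) / (N * 2 ^ m) ≤ 1 := div_le_one_of_le₀ hj' (by positivity)
    have h2 : (0 : ℝ) ≤ (j : ℝ) / (N * 2 ^ m) := by positivity
    exact ⟨by nlinarith, by nlinarith⟩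
  have hexp4 : Real.exp (-(4 * lam)) ≤ 1 / 4 := by
    rw [Real.exp_neg, ← one_div]
    exact one_div_le_one_div_of_le (by norm_num) (by linarith [Real.add_one_le_exp (4 * lam)])
  have hEm : ∀ m j : ℕ, j < N * 2 ^ m →
      P (E m j) ≤ ENNReal.ofReal (2 * (Real.exp (-2 * lam) * (1 / 4) ^ m)) := by
    intro m j hj
    have hsucc := hmem m (j + 1) hj
    push_cast at hsucc
    have h1 := hB _ hsucc _ (hmem m j hj.le) (T * (3 / 4) ^ m)
      (by positivity)
    refine h1.trans (ENNReal.ofReal_le_ofReal ?_)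
    have hdist : |p + ℓ * (((j : ℝ) + 1) / (N * 2 ^ m)) - (p + ℓ * (j / (N * 2 ^ m)))| =
        ℓ / (N * 2 ^ m) := by
      rw [abs_of_nonneg]
      · field_simp; ring
      · have : p + ℓ * (((j : ℝ) + 1) / (N * 2 ^ m)) - (p + ℓ * (j / (N * 2 ^ m))) =
          ℓ / (N * 2 ^ m) := by field_simp; ring
        rw [this]; positivity
    -- Thresholds shrink by `3/4` per level and standard deviations by `1/√2`, so the exponent grows
    -- by `2 (3/4)² = 9/8 > 1`.
    have hpow : -(T * (3 / 4) ^ m) ^ 2 / (2 * (ℓ / (N * 2 ^ m))) = -(32 * lam * (9 / 8) ^ m) := by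
      rw [mul_pow, hT2, ← pow_mul, mul_comm m 2, pow_mul]
      have : ((9 : ℝ) / 8) ^ m = ((3 / 4) ^ 2) ^ m * 2 ^ m := by
        rw [← mul_pow]; norm_num
      rw [this]
      field_simp
      norm_num
    rw [hdist, hpow]
    have hbern : 1 + (m : ℝ) * (1 / 8) ≤ (9 / 8) ^ m := by
      have := one_add_mul_le_pow (a := (1 / 8 : ℝ)) (by norm_num) m
      norm_num at this ⊢
      exact this
    -- Bernoulli's inequality gives a decay of `exp (-4 lam) ≤ 1/4` per level, enough to beat the
    -- doubling of the number of cells.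
    have hle : -(32 * lam * (9 / 8) ^ m) ≤ -2 * lam + m * -(4 * lam) := by
      have : 32 * lam * (1 + (m : ℝ) * (1 / 8)) ≤ 32 * lam * (9 / 8) ^ m := by gcongr
      nlinarith
    have := Real.exp_le_exp.2 hle
    rw [Real.exp_add, Real.exp_nat_mul] at this
    have h3 : Real.exp (-(4 * lam)) ^ m ≤ (1 / 4) ^ m := by gcongr
    have h4 := mul_le_mul_of_nonneg_left h3 (Real.exp_pos (-2 * lam)).le
    linarith
  calc _ ≤ P (⋃ m, ⋃ j ∈ Finset.range (N * 2 ^ m), E m j) := by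
        refine measure_mono ?_
        rintro ω ⟨m, j, hj, hω⟩
        simp only [mem_iUnion, Finset.mem_range, hE]
        exact ⟨m, j, hj, hω.le⟩
    _ ≤ ∑' m, P (⋃ j ∈ Finset.range (N * 2 ^ m), E m j) := measure_iUnion_le _
    _ ≤ ∑' m : ℕ, ENNReal.ofReal (2 * N * Real.exp (-2 * lam) * (1 / 2) ^ m) := by
        refine ENNReal.tsum_le_tsum fun m ↦ ?_
        refine (measure_biUnion_finset_le _ _).trans ?_
        refine (Finset.sum_le_sum fun j hj ↦ hEm m j (Finset.mem_range.1 hj)).trans ?_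
        rw [Finset.sum_const, Finset.card_range, nsmul_eq_mul, ← ENNReal.ofReal_natCast,
          ← ENNReal.ofReal_mul (by positivity)]
        refine ENNReal.ofReal_le_ofReal (le_of_eq ?_)
        have : ((1 : ℝ) / 2) ^ m = 2 ^ m * (1 / 4) ^ m := by rw [← mul_pow]; norm_num
        rw [this]
        push_cast
        ring
    _ = ENNReal.ofReal (4 * N * Real.exp (-2 * lam)) := by
        rw [← ENNReal.ofReal_tsum_of_nonneg (fun m ↦ by positivity)
          (summable_geometric_two.mul_left _), tsum_mul_left, tsum_geometric_two]
        congr 1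
        ring

/-- Oscillation of a continuous path whose grid increments stay below the chaining thresholds. -/
lemma abs_sub_le_of_not_exists_grid_increment_gt {p ℓ T : ℝ} (hℓ : 0 < ℓ) (hT : 0 ≤ T) {N : ℕ}
    (hN : 0 < N) {β : ℝ → ℝ} (hβ : ContinuousOn β (Icc p (p + ℓ)))
    (hstep : ¬∃ m j : ℕ, j < N * 2 ^ m ∧ T * (3 / 4) ^ m <
      |β (p + ℓ * ((j + 1) / (N * 2 ^ m))) - β (p + ℓ * (j / (N * 2 ^ m)))|)
    {x y : ℝ} (hx : x ∈ Icc p (p + ℓ)) (hy : y ∈ Icc p (p + ℓ)) :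
    |β x - β y| ≤ 7 * T + T * N * (|x - y| / ℓ) := by
  push Not at hstep
  have hmem : ∀ {x}, x ∈ Icc p (p + ℓ) → (x - p) / ℓ ∈ Icc (0 : ℝ) 1 := fun {x} hx ↦
    ⟨div_nonneg (by linarith [hx.1]) hℓ.le, div_le_one_of_le₀ (by linarith [hx.2]) hℓ.le⟩
  have hc : ContinuousOn (fun u ↦ β (p + ℓ * u)) (Icc 0 1) := by
    refine hβ.comp (by fun_prop) fun u hu ↦ ?_
    exact ⟨by nlinarith [hu.1], by nlinarith [hu.2]⟩
  have := abs_sub_le_of_grid_increments hN hT hc hstep (hmem hx) (hmem hy)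
  have e : ∀ x, p + ℓ * ((x - p) / ℓ) = x := fun x ↦ by field_simp; ring
  rw [e, e, ← sub_div, abs_div, abs_of_pos hℓ, sub_sub_sub_cancel_right] at this
  exact this

end Gaussian

/-! ### The distance between a process and its least concave majorant -/

lemma IsSmoothIncreasing.exists_lipschitz {a b : ℝ} {L : ℝ → ℝ} (hL : IsSmoothIncreasing a b L)
    (hab : a < b) :
    ∃ C, 0 ≤ C ∧ ∀ x ∈ Icc a b, ∀ y ∈ Icc a b, |L x - L y| ≤ C * |x - y| := by
  obtain ⟨c, C, hc, hC⟩ := hL.deriv_bounds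
  have ha := hC a (left_mem_Icc.2 hab.le)
  refine ⟨C, by linarith, fun x hx y hy ↦ ?_⟩
  refine (convex_Icc a b).norm_image_sub_le_of_norm_derivWithin_le
    (hL.contDiffOn.differentiableOn one_ne_zero) (fun t ht ↦ ?_) hy hx
  rw [Real.norm_of_nonneg (hc.le.trans (hC t ht).1)]
  exact (hC t ht).2

lemma IsSmoothIncreasing.lt {a b : ℝ} {L : ℝ → ℝ} (hL : IsSmoothIncreasing a b L)
    (hab : a < b) : L a < L b := by
  obtain ⟨c, C, hc, hC⟩ := hL.deriv_bounds
  have hd := hL.contDiffOn.differentiableOn one_ne_zero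
  refine strictMonoOn_of_deriv_pos (convex_Icc a b) hL.contDiffOn.continuousOn (fun x hx ↦ ?_)
    (left_mem_Icc.2 hab.le) (right_mem_Icc.2 hab.le) hab
  rw [interior_Icc] at hx
  rw [← derivWithin_of_mem_nhds (Icc_mem_nhds hx.1 hx.2)]
  exact hc.trans_le (hC x ⟨hx.1.le, hx.2.le⟩).1

lemma IsSmoothDecreasing.exists_sub_le {a b : ℝ} {f : ℝ → ℝ} (hf : IsSmoothDecreasing a b f) :
    ∃ c, 0 < c ∧ ∀ x ∈ Icc a b, ∀ y ∈ Icc a b, x ≤ y → f y - f x ≤ -c * (y - x) := by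
  obtain ⟨c, C, hc, hC⟩ := hf.abs_deriv_bounds
  have hd := hf.contDiffOn.differentiableOn one_ne_zero
  refine ⟨c, hc, (convex_Icc a b).image_sub_le_mul_sub_of_deriv_le hf.contDiffOn.continuousOn
    (hd.mono interior_subset) fun x hx ↦ ?_⟩
  rw [interior_Icc] at hx
  rw [← derivWithin_of_mem_nhds (Icc_mem_nhds hx.1 hx.2)]
  have h1 := (hC x ⟨hx.1.le, hx.2.le⟩).1
  rw [abs_of_nonpos hf.antitoneOn.derivWithin_nonpos] at h1
  linarith

/-- The primitive of a function with derivative at most `-c` is strongly concave. -/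
lemma IsSmoothDecreasing.exists_integral_le {a b : ℝ} {f : ℝ → ℝ} (hf : IsSmoothDecreasing a b f) :
    ∃ c, 0 < c ∧ ∀ t ∈ Icc a b, ∀ x ∈ Icc a b,
      ∫ y in a..x, f y ≤ (∫ y in a..t, f y) + f t * (x - t) - c / 2 * (x - t) ^ 2 := by
  obtain ⟨c, hc, hsub⟩ := hf.exists_sub_le
  refine ⟨c, hc, fun t ht x hx ↦ ?_⟩
  have hint : ∀ u ∈ Icc a b, ∀ v ∈ Icc a b, IntervalIntegrable f volume u v := fun u hu v hv ↦
    (hf.contDiffOn.continuousOn.mono (uIcc_subset_Icc hu hv)).intervalIntegrable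
  have ha : a ∈ Icc a b := ⟨le_rfl, ht.1.trans ht.2⟩
  rw [← intervalIntegral.integral_add_adjacent_intervals (hint a ha t ht) (hint t ht x hx)]
  -- The integrand `f` lies below this affine function to the right of `t` and above it to the left;
  -- integrating away from `t` gives the same upper bound on both sides.
  have hq : ∀ u v, ∫ y in u..v, (f t - c * (y - t)) =
      (f t * v - c / 2 * (v - t) ^ 2) - (f t * u - c / 2 * (u - t) ^ 2) := by
    intro u v
    refine intervalIntegral.integral_eq_sub_of_hasDerivAt
      (f := fun y ↦ f t * y - c / 2 * (y - t) ^ 2) (fun y _ ↦ ?_)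
      (Continuous.intervalIntegrable (by fun_prop) _ _)
    have h1 := ((hasDerivAt_id y).const_mul (f t)).sub
      ((((hasDerivAt_id y).sub_const t).pow 2).const_mul (c / 2))
    convert! h1 using 1
    simp
    ring
  have hqi : ∀ u v, IntervalIntegrable (fun y ↦ f t - c * (y - t)) volume u v := fun u v ↦
    Continuous.intervalIntegrable (by fun_prop) _ _
  rcases le_total t x with h | h
  · have := intervalIntegral.integral_mono_on h (hint t ht x hx) (hqi t x) fun y hy ↦ by
      have := hsub t ht y ⟨ht.1.trans hy.1, hy.2.trans hx.2⟩ hy.1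
      linarith
    rw [hq] at this
    linarith
  · have := intervalIntegral.integral_mono_on h (hqi x t) (hint x hx t ht) fun y hy ↦ by
      have := hsub y ⟨hx.1.trans hy.1, hy.2.trans ht.2⟩ t ht hy.2
      linarith
    rw [hq] at this
    rw [intervalIntegral.integral_symm x t]
    linarith

/-- A perturbation of a strongly concave function is close to its least concave majorant if the
increments of the perturbation are small compared to the curvature. -/
lemma abs_leastConcaveMajorant_sub_le_of_strongly_concave {a b c M A A' δ R : ℝ}
    {F f w G : ℝ → ℝ} (hc : 0 < c)
    (hF : ∀ t ∈ Icc a b, ∀ x ∈ Icc a b, F x ≤ F t + f t * (x - t) - c / 2 * (x - t) ^ 2)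
    (hw : ∀ t ∈ Icc a b, ∀ x ∈ Icc a b, |w x - w t| ≤ A * δ ^ 2 + A' * δ * |x - t|)
    (hR : ∀ t ∈ Icc a b, |G t - F t - w t| ≤ R) (hM : ∀ x ∈ Icc a b, G x ≤ M)
    {t : ℝ} (ht : t ∈ Icc a b) :
    |leastConcaveMajorant a b G t - G t| ≤ (A + A' ^ 2 / (2 * c)) * δ ^ 2 + 2 * R := by
  refine abs_leastConcaveMajorant_sub_le (p := f) hM (fun t ht x hx ↦ ?_) ht
  have h1 := hF t ht x hx
  have h2 := (le_abs_self _).trans (hw t ht x hx)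
  have h3 := abs_le.1 (hR t ht)
  have h4 := abs_le.1 (hR x hx)
  -- Completing the square: the quadratic term is exactly what strong concavity pays for.
  have h5 : A' * δ * |x - t| ≤ A' ^ 2 / (2 * c) * δ ^ 2 + c / 2 * (x - t) ^ 2 := by
    rw [← sq_abs (x - t)]
    have : A' ^ 2 / (2 * c) * δ ^ 2 + c / 2 * |x - t| ^ 2 - A' * δ * |x - t| =
        (A' * δ - c * |x - t|) ^ 2 / (2 * c) := by field_simp; ring
    have : 0 ≤ (A' * δ - c * |x - t|) ^ 2 / (2 * c) := by positivity
    linarith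
  linarith

/-! ### Rates -/

/-- The scale `(log n / n) ^ (1/3)`. -/
noncomputable def logScale (n : ℕ) : ℝ := (Real.log n / n) ^ (1 / 3 : ℝ)

/-- The number of cells of the coarsest grid used in chaining. -/
noncomputable def cellCount (n : ℕ) : ℕ := ⌈(logScale n)⁻¹⌉₊

lemma one_le_log_natCast {n : ℕ} (hn : 3 ≤ n) : 1 ≤ Real.log n := by
  rw [Real.le_log_iff_exp_le (by positivity)]
  have : (3 : ℝ) ≤ n := by exact_mod_cast hn
  linarith [Real.exp_one_lt_d9]

lemma logScale_pos {n : ℕ} (hn : 3 ≤ n) : 0 < logScale n := by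
  have := one_le_log_natCast hn
  unfold logScale
  positivity

lemma logScale_pow_three {n : ℕ} (hn : 3 ≤ n) : logScale n ^ 3 = Real.log n / n := by
  have := one_le_log_natCast hn
  rw [logScale, ← Real.rpow_natCast, ← Real.rpow_mul (by positivity)]
  norm_num

lemma logScale_sq (n : ℕ) : logScale n ^ 2 = (Real.log n / n) ^ (2 / 3 : ℝ) := by
  have : 0 ≤ Real.log n / n := by positivity
  rw [logScale, ← Real.rpow_natCast, ← Real.rpow_mul this]
  norm_num

lemma logScale_le_one {n : ℕ} (hn : 3 ≤ n) : logScale n ≤ 1 := by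
  have := one_le_log_natCast hn
  refine Real.rpow_le_one (by positivity) ?_ (by norm_num)
  rw [div_le_one (by positivity)]
  exact Real.log_le_self (by positivity)

lemma inv_logScale_le {n : ℕ} (hn : 3 ≤ n) : (logScale n)⁻¹ ≤ n := by
  have hn' : (3 : ℝ) ≤ n := by exact_mod_cast hn
  have h1 : ((n : ℝ)⁻¹) ^ 3 ≤ logScale n ^ 3 := by
    rw [logScale_pow_three hn, inv_pow, inv_le_comm₀ (by positivity)
      (div_pos (by linarith [one_le_log_natCast hn]) (by positivity)), inv_div]
    have : (n : ℝ) / Real.log n ≤ n := div_le_self (by positivity) (one_le_log_natCast hn)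
    exact this.trans (le_self_pow₀ (by linarith) (by norm_num))
  have h2 := le_of_pow_le_pow_left₀ (by norm_num) (logScale_pos hn).le h1
  exact inv_le_of_inv_le₀ (by positivity) h2

lemma inv_logScale_le_cellCount (n : ℕ) : (logScale n)⁻¹ ≤ cellCount n := Nat.le_ceil _

lemma cellCount_pos {n : ℕ} (hn : 3 ≤ n) : 0 < cellCount n :=
  Nat.ceil_pos.2 (inv_pos.2 (logScale_pos hn))

lemma cellCount_le {n : ℕ} (hn : 3 ≤ n) : (cellCount n : ℝ) ≤ 2 * (logScale n)⁻¹ := by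
  have h1 := (Nat.ceil_lt_add_one (inv_pos.2 (logScale_pos hn)).le).le
  have h2 := (one_le_inv₀ (logScale_pos hn)).2 (logScale_le_one hn)
  unfold cellCount
  linarith

/-- This is the balance that fixes the exponent `1/3`: with at least `1/δ` cells the left side is at
most `√(ℓ (log n / n) δ)`, and `log n / n = δ³`. -/
lemma rpow_mul_sqrt_le {n : ℕ} (hn : 3 ≤ n) {ℓ : ℝ} (hℓ : 0 < ℓ) :
    (n : ℝ) ^ (-(1 / 2) : ℝ) * √(ℓ * Real.log n / cellCount n) ≤ √ℓ * logScale n ^ 2 := by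
  have hn' : (0 : ℝ) < n := by positivity
  have hlog := one_le_log_natCast hn
  have hδ := logScale_pos hn
  rw [Real.rpow_neg hn'.le, ← Real.sqrt_eq_rpow, ← Real.sqrt_inv, ← Real.sqrt_mul (by positivity)]
  have e : √ℓ * logScale n ^ 2 = √(ℓ * logScale n ^ 4) := by
    rw [Real.sqrt_mul hℓ.le, show logScale n ^ 4 = (logScale n ^ 2) ^ 2 by ring,
      Real.sqrt_sq (by positivity)]
  rw [e]
  refine Real.sqrt_le_sqrt ?_
  have h1 : (cellCount n : ℝ)⁻¹ ≤ logScale n :=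
    inv_le_of_inv_le₀ hδ (inv_logScale_le_cellCount n)
  calc (n : ℝ)⁻¹ * (ℓ * Real.log n / cellCount n)
      = ℓ * (Real.log n / n) * (cellCount n : ℝ)⁻¹ := by ring
    _ ≤ ℓ * (Real.log n / n) * logScale n := by gcongr
    _ = ℓ * logScale n ^ 4 := by rw [← logScale_pow_three hn]; ring

/-- With `lam = log n` the exponential is `n⁻²`, while there are at most `2n` cells. -/
lemma tendsto_cellCount_mul_exp :
    Tendsto (fun n : ℕ ↦ ENNReal.ofReal (4 * cellCount n * Real.exp (-2 * Real.log n))) atTop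
      (𝓝 0) := by
  rw [← ENNReal.ofReal_zero]
  refine (ENNReal.continuous_ofReal.tendsto 0).comp ?_
  have h0 : Tendsto (fun n : ℕ ↦ (8 : ℝ) / n) atTop (𝓝 0) := tendsto_const_div_atTop_nhds_zero_nat 8
  refine squeeze_zero' (Eventually.of_forall fun n ↦ by positivity) ?_ h0
  filter_upwards [eventually_ge_atTop 3] with n hn
  have hn' : (0 : ℝ) < n := by positivity
  have h1 : Real.exp (-2 * Real.log n) = ((n : ℝ) ^ 2)⁻¹ := by
    rw [neg_mul, Real.exp_neg, mul_comm, Real.exp_mul, Real.exp_log hn']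
    norm_num
  have h2 : (cellCount n : ℝ) ≤ 2 * n :=
    (cellCount_le hn).trans (mul_le_mul_of_nonneg_left (inv_logScale_le hn) (by norm_num))
  rw [h1]
  calc 4 * (cellCount n : ℝ) * ((n : ℝ) ^ 2)⁻¹ ≤ 4 * (2 * n) * ((n : ℝ) ^ 2)⁻¹ := by gcongr
    _ = 8 / n := by field_simp; norm_num

/-! ### Suprema and stochastic order -/

lemma supAbs_le_ofReal_iff {a b C : ℝ} (hC : 0 ≤ C) {g : ℝ → ℝ} :
    supAbs a b g ≤ ENNReal.ofReal C ↔ ∀ t ∈ Icc a b, |g t| ≤ C := by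
  simp only [supAbs, iSup₂_le_iff, Real.enorm_eq_ofReal_abs, ENNReal.ofReal_le_ofReal_iff hC]

/-- A Kiefer-Wolfowitz type bound: a process which is close to a strongly concave function plus a
rescaled, time-changed Brownian motion or bridge is close to its least concave majorant. -/
theorem isBigOInProb_supAbs_leastConcaveMajorant_sub {a b : ℝ} (hab : a < b)
    {Ω : ℕ → Type*} [∀ n, MeasurableSpace (Ω n)]
    (P : ∀ n, Measure (Ω n)) [∀ n, IsProbabilityMeasure (P n)]
    {f L : ℝ → ℝ} (hf : IsSmoothDecreasing a b f) (hL : IsSmoothIncreasing a b L)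
    {Fn : ∀ n, Ω n → ℝ → ℝ} (hFn : ∀ n ω, IsCadlagStepOn a b (Fn n ω))
    {B : ∀ n, ℝ → Ω n → ℝ}
    (hB : ∀ n, IsBrownianMotionOn (Icc (L a) (L b)) (B n) (P n) ∨
      IsBrownianBridgeOn (Icc (L a) (L b)) (B n) (P n))
    {γ : ℕ → ℝ}
    (hγ : γ =O[atTop] fun n : ℕ ↦ (Real.log n / n) ^ (2 / 3 : ℝ))
    (happrox : IsBigOInProb P
      (fun n ω ↦ supAbs a b fun t ↦
        Fn n ω t - (∫ x in a..t, f x) - (n : ℝ) ^ (-(1 / 2) : ℝ) * B n (L t) ω)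
      (fun n _ ↦ γ n)) :
    IsBigOInProb P
      (fun n ω ↦ supAbs a b fun t ↦ leastConcaveMajorant a b (Fn n ω) t - Fn n ω t)
      (fun n _ ↦ (Real.log n / n) ^ (2 / 3 : ℝ)) := by
  intro ε hε
  obtain ⟨M, hM, hevM⟩ := happrox (ε / 2) (by linarith)
  obtain ⟨Cγ, hCγ, hγ'⟩ := hγ.exists_pos
  rw [Asymptotics.isBigOWith_iff] at hγ'
  obtain ⟨c, hc, hF⟩ := hf.exists_integral_le
  obtain ⟨CL, hCL, hLip⟩ := hL.exists_lipschitz hab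
  set ℓ := L b - L a with hℓ
  have hℓ0 : 0 < ℓ := sub_pos.2 (hL.lt hab)
  have hLb : L a + ℓ = L b := by rw [hℓ]; ring
  have hLmem : ∀ t ∈ Icc a b, L t ∈ Icc (L a) (L a + ℓ) := fun t ht ↦ by
    rw [hLb]
    exact ⟨hL.monotoneOn (left_mem_Icc.2 hab.le) ht ht.1,
      hL.monotoneOn ht (right_mem_Icc.2 hab.le) ht.2⟩
  -- Here `56 = 7 · 8`, with `7` from the oscillation bound and `8` from the threshold `T`; in `A'`,
  -- `16 = 8 · 2`, since there are at most `2/δ` cells.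
  set A := 56 * √ℓ with hA
  set A' := 16 * √ℓ * CL / ℓ with hA'
  refine ⟨A + A' ^ 2 / (2 * c) + 2 * (M * Cγ), by positivity, ?_⟩
  have hsmall : ∀ᶠ n : ℕ in atTop,
      ENNReal.ofReal (4 * cellCount n * Real.exp (-2 * Real.log n)) ≤ ENNReal.ofReal (ε / 2) :=
    (tendsto_cellCount_mul_exp.eventually_lt_const (by simpa using hε)).mono fun _ h ↦ h.le
  filter_upwards [hevM, hγ', hsmall, eventually_ge_atTop 3] with n hn1 hn2 hn3 hn
  have hδ := logScale_pos hn
  have hlog := one_le_log_natCast hn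
  have hN := cellCount_pos hn
  set T := 8 * √(ℓ * Real.log n / cellCount n) with hT
  -- The exceptional events are a poor approximation, a large grid increment and a discontinuous
  -- path. Only monotonicity and subadditivity of the measure are applied to them, so their
  -- measurability plays no role.
  set E₁ := {ω | ENNReal.ofReal (M * |γ n|) < supAbs a b fun t ↦
        Fn n ω t - (∫ x in a..t, f x) - (n : ℝ) ^ (-(1 / 2) : ℝ) * B n (L t) ω} with hE₁
  set E₂ := {ω | ∃ m j : ℕ, j < cellCount n * 2 ^ m ∧ T * (3 / 4) ^ m <
      |B n (L a + ℓ * ((j + 1) / (cellCount n * 2 ^ m))) ω -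
        B n (L a + ℓ * (j / (cellCount n * 2 ^ m))) ω|} with hE₂
  set E₃ := {ω | ¬ContinuousOn (fun t ↦ B n t ω) (Icc (L a) (L b))} with hE₃
  have hP3 : P n E₃ = 0 := by
    rcases hB n with h | h
    · exact h.continuousOn
    · exact h.continuousOn
  have hP2 : P n E₂ ≤ ENNReal.ofReal (ε / 2) := by
    refine (measure_exists_grid_increment_gt_le hℓ0 hlog hN fun s hs t ht x hx ↦ ?_).trans hn3
    rw [hLb] at hs ht
    rcases hB n with h | h
    · exact h.measure_abs_sub_ge_le hs ht hx
    · exact h.measure_abs_sub_ge_le hs ht hx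
  have hsub : {ω | ENNReal.ofReal ((A + A' ^ 2 / (2 * c) + 2 * (M * Cγ)) *
      |(Real.log n / n) ^ (2 / 3 : ℝ)|) <
      supAbs a b fun t ↦ leastConcaveMajorant a b (Fn n ω) t - Fn n ω t} ⊆ E₁ ∪ (E₂ ∪ E₃) := by
    intro ω hω
    by_contra hnot
    simp only [mem_union, not_or] at hnot
    obtain ⟨h1, h2, h3⟩ := hnot
    rw [hE₁, mem_ofPred_eq, not_lt, supAbs_le_ofReal_iff (by positivity)] at h1
    rw [hE₃, mem_ofPred_eq, not_not, ← hLb] at h3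
    refine not_le.2 hω ((supAbs_le_ofReal_iff (by positivity)).2 fun t ht ↦ ?_)
    obtain ⟨MG, hMG⟩ := (hFn n ω).exists_abs_le
    have hw : ∀ t ∈ Icc a b, ∀ x ∈ Icc a b,
        |(n : ℝ) ^ (-(1 / 2) : ℝ) * B n (L x) ω - (n : ℝ) ^ (-(1 / 2) : ℝ) * B n (L t) ω| ≤
          A * logScale n ^ 2 + A' * logScale n * |x - t| := by
      intro t ht x hx
      have hosc := abs_sub_le_of_not_exists_grid_increment_gt hℓ0 (by positivity) hN h3 h2
        (hLmem x hx) (hLmem t ht)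
      have hroot : (n : ℝ) ^ (-(1 / 2) : ℝ) * T ≤ 8 * (√ℓ * logScale n ^ 2) := by
        have := rpow_mul_sqrt_le hn hℓ0
        rw [hT]
        linarith
      have hpos : (0 : ℝ) ≤ (n : ℝ) ^ (-(1 / 2) : ℝ) := by positivity
      rw [← mul_sub, abs_mul, abs_of_nonneg hpos]
      calc _ ≤ (n : ℝ) ^ (-(1 / 2) : ℝ) * (7 * T + T * cellCount n * (|L x - L t| / ℓ)) := by
            gcongr
        _ = (n : ℝ) ^ (-(1 / 2) : ℝ) * T * (7 + cellCount n * (|L x - L t| / ℓ)) := by ring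
        _ ≤ 8 * (√ℓ * logScale n ^ 2) * (7 + 2 * (logScale n)⁻¹ * (CL * |x - t| / ℓ)) := by
            gcongr
            · exact cellCount_le hn
            · exact hLip x hx t ht
        _ = A * logScale n ^ 2 + A' * logScale n * |x - t| := by
            rw [hA, hA']; field_simp; ring
    have key := abs_leastConcaveMajorant_sub_le_of_strongly_concave hc hF hw h1
      (fun x hx ↦ (le_abs_self _).trans (hMG x hx)) ht
    have hγn : |γ n| ≤ Cγ * logScale n ^ 2 := by
      rw [← logScale_sq n] at hn2
      simpa using hn2
    refine key.trans ?_
    rw [← logScale_sq, abs_of_nonneg (sq_nonneg (logScale n))]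
    have := mul_le_mul_of_nonneg_left hγn hM.le
    linarith
  calc _ ≤ P n (E₁ ∪ (E₂ ∪ E₃)) := measure_mono hsub
    _ ≤ P n E₁ + (P n E₂ + P n E₃) :=
        (measure_union_le _ _).trans (add_le_add le_rfl (measure_union_le _ _))
    _ ≤ ENNReal.ofReal (ε / 2) + (ENNReal.ofReal (ε / 2) + 0) := by
        rw [hP3]
        gcongr
    _ = ENNReal.ofReal ε := by
        rw [add_zero, ← ENNReal.ofReal_add (by linarith) (by linarith), add_halves]

theorem lemma3
    {a b : ℝ} (hab : a < b)
    {Ω : ℕ → Type*} [∀ n, MeasurableSpace (Ω n)]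
    (P : ∀ n, Measure (Ω n)) [∀ n, IsProbabilityMeasure (P n)]
    -- the target `f`, with primitive `F t = ∫ x in a..t, f x`, and the time change `L`
    (f L : ℝ → ℝ) (hf : IsSmoothDecreasing a b f) (hL : IsSmoothIncreasing a b L)
    -- the step estimators `F_n`
    (Fn : ∀ n, Ω n → ℝ → ℝ) (hFn : ∀ n ω, IsCadlagStepOn a b (Fn n ω))
    -- the approximating processes `B_n` on `[L a, L b]`
    (B : ∀ n, ℝ → Ω n → ℝ)
    (hB : ∀ n, IsBrownianMotionOn (Icc (L a) (L b)) (B n) (P n) ∨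
      IsBrownianBridgeOn (Icc (L a) (L b)) (B n) (P n))
    -- the approximation `sup |F_n - F - n^{-1/2} B_n ∘ L| = O_p(γ_n)`
    (γ : ℕ → ℝ)
    (hγ : γ =O[atTop] fun n : ℕ ↦ (Real.log n / n) ^ (2 / 3 : ℝ))
    (happrox : IsBigOInProb P
      (fun n ω ↦ supAbs a b fun t ↦
        Fn n ω t - (∫ x in a..t, f x) - (n : ℝ) ^ (-(1 / 2) : ℝ) * B n (L t) ω)
      (fun n _ ↦ γ n))
    -- the kernel and the bandwidths
    (K : ℝ → ℝ) (hK : IsKernel K) (hK' : HasIntegrableDerivatives K)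
    (h : ∀ n, Ω n → ℝ) (h_pos : ∀ n ω, 0 < h n ω)
    (h_le : Tendsto (fun n ↦ P n {ω | b - a < 2 * h n ω}) atTop (𝓝 0)) :
    (∀ n ω, 2 * h n ω ≤ b - a →
      DifferentiableOn ℝ (smoothedGrenander a b K (h n ω) (Fn n ω)) (Icc a b) ∧
      DifferentiableOn ℝ (kernelEstimator a b K (h n ω) (Fn n ω)) (Icc a b)) ∧
    ∀ l : ℕ, l ≤ 1 →
      IsBigOInProb P
        (fun n ω ↦ supAbs a b fun t ↦
          iteratedDerivWithin l (smoothedGrenander a b K (h n ω) (Fn n ω)) (Icc a b) t -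
            iteratedDerivWithin l (kernelEstimator a b K (h n ω) (Fn n ω)) (Icc a b) t)
        (fun n ω ↦ (h n ω ^ (1 + l))⁻¹ *
          ((n : ℝ) ^ (-(2 / 3) : ℝ) * Real.log n ^ (2 / 3 : ℝ))) := by
  have hBV : ∀ n ω, BoundedVariationOn (extendConst a b (Fn n ω)) univ := fun n ω ↦
    (hFn n ω).boundedVariationOn.extendConst hab.le
  have hBV' : ∀ n ω, BoundedVariationOn
      (extendConst a b (leastConcaveMajorant a b (Fn n ω))) univ := fun n ω ↦
    ((hFn n ω).boundedVariationOn_leastConcaveMajorant hab).extendConst hab.le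
  refine ⟨fun n ω hle ↦ ⟨fun t _ ↦ ?_, fun t _ ↦ ?_⟩, fun l hl ε hε ↦ ?_⟩
  · exact (hasDerivAt_kernelEstimator hK hK' (h_pos n ω) hle
      (hBV' n ω) t).differentiableAt.differentiableWithinAt
  · exact (hasDerivAt_kernelEstimator hK hK' (h_pos n ω) hle
      (hBV n ω) t).differentiableAt.differentiableWithinAt
  obtain ⟨M, hM, hev⟩ := isBigOInProb_supAbs_leastConcaveMajorant_sub hab P hf hL hFn hB hγ happrox
    (ε / 2) (by linarith)
  have hk : 0 ≤ (∫ u, |deriv K u|) + ∫ u, |deriv (deriv K) u| :=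
    add_nonneg (integral_nonneg fun _ ↦ abs_nonneg _) (integral_nonneg fun _ ↦ abs_nonneg _)
  have hsmall : ∀ᶠ n in atTop, P n {ω | b - a < 2 * h n ω} ≤ ENNReal.ofReal (ε / 2) :=
    (h_le.eventually_lt_const (by simpa using hε)).mono fun _ h ↦ h.le
  -- The summand `1` makes strict positivity of the constant immediate.
  refine ⟨((∫ u, |deriv K u|) + ∫ u, |deriv (deriv K) u|) * M + 1, by positivity, ?_⟩
  filter_upwards [hev, hsmall, eventually_ge_atTop 1] with n hn1 hn2 hn
  have hlog : 0 ≤ Real.log n := Real.log_natCast_nonneg n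
  have hrate : (Real.log n / n) ^ (2 / 3 : ℝ) =
      (n : ℝ) ^ (-(2 / 3) : ℝ) * Real.log n ^ (2 / 3 : ℝ) := by
    rw [Real.div_rpow hlog (Nat.cast_nonneg n), Real.rpow_neg (Nat.cast_nonneg n)]
    ring
  simp only [hrate] at hn1
  set r := (n : ℝ) ^ (-(2 / 3) : ℝ) * Real.log n ^ (2 / 3 : ℝ) with hr
  have hr0 : 0 ≤ r := by positivity
  refine (measure_mono (t := {ω | ENNReal.ofReal (M * |r|) < supAbs a b fun t ↦
    leastConcaveMajorant a b (Fn n ω) t - Fn n ω t} ∪ {ω | b - a < 2 * h n ω}) ?_).trans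
    ((measure_union_le _ _).trans ((add_le_add hn1 hn2).trans_eq ?_))
  · intro ω hω
    by_contra hnot
    simp only [mem_union, mem_ofPred_eq, not_or, not_lt] at hnot
    obtain ⟨h1, h2⟩ := hnot
    rw [supAbs_le_ofReal_iff (by positivity)] at h1
    have hh := h_pos n ω
    refine not_le.2 hω ((supAbs_le_ofReal_iff (by positivity)).2 fun t ht ↦ ?_)
    refine (abs_iteratedDerivWithin_kernelEstimator_sub_le hK hK' hh h2 (hBV n ω) (hBV' n ω)
      h1 hl ht).trans ?_
    have hp : 0 ≤ (h n ω ^ (1 + l))⁻¹ := by positivity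
    rw [abs_of_nonneg hr0, abs_of_nonneg (by positivity)]
    have : 0 ≤ (h n ω ^ (1 + l))⁻¹ * r := by positivity
    linarith
  · rw [← ENNReal.ofReal_add (by linarith) (by linarith), add_halves]
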